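/- **Wavelet bases.** Let $\phi=\mathbf 1_{[0,1]}$ and let $\psi,\tilde\phi,\tilde\psi:\mathbb R\to\mathbb R$. Put $\Lambda=\{(j,k):j\ge -1,\ k\in\mathbb Z\}$ and, for $k\in\mathbb Z$ and $j\ge 0$, $$\psi_{-1k}(x)=\phi(x-k),\quad \psi_{jk}(x)=2^{j/2}\psi(2^jx-k),\quad \tilde\psi_{-1k}(x)=\tilde\phi(x-k),\quad \tilde\psi_{jk}(x)=2^{j/2}\tilde\psi(2^jx-k).$$ Assume that $\psi,\tilde\phi,\tilde\psi$ generate a biorthogonal wavelet basis with smoothness parameter $r\ge 0$, that is: $\psi,\tilde\phi,\tilde\psi$ are compactly supported; $\psi$ is piecewise constant and orthogonal to all polynomials of degree at most $r$; $\int\psi_{jk}\tilde\psi_{j'k'}=\mathbf 1_{(j,k)=(j',k')}$ for all $(j,k),(j',k')\in\Lambda$; every $g\in L_2(\mathbb R)$ satisfies $g=\sum_{(j,k)\in\Lambda}\left(\int\psi_{jk}g\right)\tilde\psi_{jk}$, with unconditional convergence in $L_2(\mathbb R)$; and either $r>0$ and $\tilde\phi,\tilde\psi$ belong to the Hölder space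 $C^{r+1}$, or $r=0$ and the basis is the Haar basis $\tilde\phi=\phi$, $\tilde\psi=\psi=\mathbf 1_{[0,1/2)}-\mathbf 1_{[1/2,1]}$. **Estimator.** Let $X_1,\dots,X_n$ be i.i.d. with a density $f\in L_2(\mathbb R)$ (nothing else is assumed on $f$; it need not be bounded or compactly supported), and set $$\beta_{jk}=\int\psi_{jk}f,\qquad \sigma_{jk}^2=\int\psi_{jk}^2f-\beta_{jk}^2,\qquad \hat\beta_{jk}=\frac1n\sum_{i=1}^n\psi_{jk}(X_i),$$ $$\hat\sigma_{jk}^2=\frac1{n(n-1)}\sum_{i=2}^n\sum_{l=1}^{i-1}(\psi_{jk}(X_i)-\psi_{jk}(X_l))^2.$$ Let $c\ge 1$, $c'\in\mathbb R$, $\gamma>0$, let $j_0=\lfloor\log_2\lfloor n^c(\ln n)^{c'}\rfloor\rfloor$, $\Gamma_n=\{(j,k):-1\le j\le j_0,\ k\in\mathbb Z\}$ and, with $\|\cdot\|_\infty$ the supremum norm, $$\tilde\sigma_{jk}^2=\hat\sigma_{jk}^2+2\|\psi_{jk}\|_\infty\sqrt{2\gamma\hat\sigma_{jk}^2\frac{\ln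 n}n}+8\gamma\|\psi_{jk}\|_\infty^2\frac{\ln n}n,\qquad \eta_{jk,\gamma}=\sqrt{2\gamma\tilde\sigma_{jk}^2\frac{\ln n}n}+\frac{2\|\psi_{jk}\|_\infty\gamma\ln n}{3n},$$ $$\tilde f_{n,\gamma}=\sum_{(j,k)\in\Gamma_n}\hat\beta_{jk}\,\mathbf 1_{|\hat\beta_{jk}|\ge\eta_{jk,\gamma}}\,\tilde\psi_{jk}.$$ **Theorem.** If $\gamma>c$, then there are a constant $C_1>0$ depending only on $\gamma$, $c$ and the wavelet basis, a constant $C_2>0$ depending only on $\gamma$, $c$, $c'$, $\|f\|_2$ and the wavelet basis, and an integer $N$ depending only on $\gamma$, $c$, $c'$ and the wavelet basis, such that for all $n\ge N$ $$\mathbb E\left[\|\tilde f_{n,\gamma}-f\|_2^2\right]\le C_1\left[\sum_{(j,k)\in\Gamma_n}\min\left(\beta_{jk}^2,\ \ln n\,\frac{\sigma_{jk}^2}{n}\right)+\sum_{(j,k)\in\Lambda\setminus\Gamma_n}\beta_{jk}^2\right]+\frac{C_2\ln n}{n}.$$ -/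

import Mathlib

open MeasureTheory ProbabilityTheory Filter Topology

namespace WaveletThresholding

noncomputable section

/-! ### Biorthogonal wavelet bases with piecewise constant decomposition wavelets -/

/-- The father decomposition wavelet, the indicator function of `[0, 1]`. -/
def phi : ℝ → ℝ := (Set.Icc (0 : ℝ) 1).indicator 1

/-- The Haar mother wavelet, `1` on `[0, 1/2)` and `-1` on `[1/2, 1]`. -/
def haar : ℝ → ℝ :=
  (Set.Ico (0 : ℝ) (1 / 2)).indicator 1 - (Set.Icc (1 / 2 : ℝ) 1).indicator 1

/-- The index set `{(j, k) : j ≥ -1, k ∈ ℤ}`. -/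
def Lam : Set (ℤ × ℤ) := {p | -1 ≤ p.1}

/-- The wavelet of index `(j, k)` generated by a father function `g` and a mother function `h`:
`g (x - k)` for `j = -1`, and `2 ^ (j / 2) * h (2 ^ j x - k)` for `j ≥ 0`. -/
def wavelet (g h : ℝ → ℝ) (p : ℤ × ℤ) (x : ℝ) : ℝ :=
  if p.1 = -1 then g (x - p.2)
  else (2 : ℝ) ^ ((p.1 : ℝ) / 2) * h ((2 : ℝ) ^ p.1 * x - p.2)

/-- `g` is constant on every interval that avoids a certain finite set of breakpoints. -/
def IsPiecewiseConstant (g : ℝ → ℝ) : Prop :=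
  ∃ t : Finset ℝ, ∀ x y : ℝ, x ≤ y → (∀ z ∈ Set.Icc x y, z ∉ t) → g x = g y

/-- The Hölder space of order `s > 0` on the line: with `m` the largest integer strictly less
than `s`, the function is `m` times continuously differentiable with bounded derivatives, and its
`m`-th derivative is Hölder continuous with exponent `s - m ∈ (0, 1]`. -/
def IsHolder (s : ℝ) (g : ℝ → ℝ) : Prop :=
  ContDiff ℝ ((⌈s⌉₊ - 1 : ℕ) : WithTop ℕ∞) g ∧
  (∀ i ≤ ⌈s⌉₊ - 1, ∃ M : ℝ, ∀ x, |iteratedDeriv i g x| ≤ M) ∧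
  ∃ K : NNReal, HolderWith K (s - ((⌈s⌉₊ - 1 : ℕ) : ℝ)).toNNReal (iteratedDeriv (⌈s⌉₊ - 1) g)

/-- `psi`, `phit`, `psit` (together with the father wavelet `phi`, the indicator of `[0, 1]`)
generate a biorthogonal wavelet basis of `L²(ℝ)` with smoothness parameter `r`, whose
decomposition wavelets are piecewise constant. Either `r > 0` and the reconstruction
wavelets are Hölder of order `r + 1`, or `r = 0` and the basis is the Haar basis. -/
structure IsBiorthogonalWaveletBasis (r : ℝ) (psi phit psit : ℝ → ℝ) : Prop where
  compact_phit : HasCompactSupport phit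
  compact_psit : HasCompactSupport psit
  regularity : (0 < r ∧ IsHolder (r + 1) phit ∧ IsHolder (r + 1) psit) ∨
    (r = 0 ∧ psi = haar ∧ phit = phi ∧ psit = haar)
  compact_psi : HasCompactSupport psi
  piecewise_psi : IsPiecewiseConstant psi
  moments : ∀ P : Polynomial ℝ, (P.natDegree : ℝ) ≤ r → ∫ x, psi x * P.eval x = 0
  biorthogonal : ∀ p ∈ Lam, ∀ q ∈ Lam,
    ∫ x, wavelet phi psi p x * wavelet phit psit q x = if p = q then 1 else 0
  /-- The basis property: every square integrable `g` is the sum of its wavelet series, which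
  converges (unconditionally) in `L²(ℝ)`. -/
  decomposition : ∀ g : ℝ → ℝ, MemLp g 2 volume →
    Tendsto (fun s : Finset Lam ↦
      eLpNorm (fun x ↦ g x - ∑ p ∈ s,
        (∫ y, wavelet phi psi p y * g y) * wavelet phit psit p x) 2 volume) atTop (𝓝 0)

/-! ### Wavelet coefficients of a density -/

/-- `f` is (a version of) a probability density on the line that belongs to `L²(ℝ)`. -/
structure IsL2Density (f : ℝ → ℝ) : Prop where
  nonneg : 0 ≤ᵐ[volume] f
  integral_eq_one : ∫ x, f x = 1
  memLp : MemLp f 2 volume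

/-- The true coefficient `β_{jk}` of `f`. -/
def coef (psi f : ℝ → ℝ) (p : ℤ × ℤ) : ℝ := ∫ x, wavelet phi psi p x * f x

/-- The variance `σ²_{jk}` of `ψ_{jk}(X)` for `X` of density `f`. -/
def sigmaSq (psi f : ℝ → ℝ) (p : ℤ × ℤ) : ℝ :=
  (∫ x, wavelet phi psi p x ^ 2 * f x) - (∫ x, wavelet phi psi p x * f x) ^ 2

/-! ### The thresholding estimator, as a function of the sample `x = (x₁, …, xₙ)` -/

/-- The maximal level `j₀ = ⌊log₂ [n ^ c (ln n) ^ c']⌋`. -/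
def maxLevel (c c' : ℝ) (n : ℕ) : ℤ :=
  ⌊Real.logb 2 (⌊(n : ℝ) ^ c * Real.log n ^ c'⌋ : ℤ)⌋

/-- `Γ_n = {(j, k) : -1 ≤ j ≤ j₀, k ∈ ℤ}`. -/
def Gam (c c' : ℝ) (n : ℕ) : Set (ℤ × ℤ) := {p | -1 ≤ p.1 ∧ p.1 ≤ maxLevel c c' n}

/-- The supremum norm `‖ψ_{jk}‖_∞`. -/
def supNorm (psi : ℝ → ℝ) (p : ℤ × ℤ) : ℝ := ⨆ x : ℝ, |wavelet phi psi p x|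

/-- The empirical coefficient. -/
def betaHat (psi : ℝ → ℝ) {n : ℕ} (x : Fin n → ℝ) (p : ℤ × ℤ) : ℝ :=
  (1 / (n : ℝ)) * ∑ i, wavelet phi psi p (x i)

/-- The unbiased estimator of the variance. -/
def sigmaHatSq (psi : ℝ → ℝ) {n : ℕ} (x : Fin n → ℝ) (p : ℤ × ℤ) : ℝ :=
  (1 / ((n : ℝ) * ((n : ℝ) - 1))) *
    ∑ i, ∑ l ∈ Finset.Iio i, (wavelet phi psi p (x i) - wavelet phi psi p (x l)) ^ 2

/-- The slightly overestimated variance. -/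
def sigmaTildeSq (γ : ℝ) (psi : ℝ → ℝ) {n : ℕ} (x : Fin n → ℝ) (p : ℤ × ℤ) : ℝ :=
  sigmaHatSq psi x p
    + 2 * supNorm psi p * √(2 * γ * sigmaHatSq psi x p * (Real.log n / n))
    + 8 * γ * supNorm psi p ^ 2 * (Real.log n / n)

/-- The data-driven threshold `η_{jk,γ}`. -/
def eta (γ : ℝ) (psi : ℝ → ℝ) {n : ℕ} (x : Fin n → ℝ) (p : ℤ × ℤ) : ℝ :=
  √(2 * γ * sigmaTildeSq γ psi x p * (Real.log n / n))
    + 2 * supNorm psi p * γ * Real.log n / (3 * n)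

/-- The hard-thresholded empirical coefficient. -/
def betaTilde (γ : ℝ) (psi : ℝ → ℝ) {n : ℕ} (x : Fin n → ℝ) (p : ℤ × ℤ) : ℝ :=
  if eta γ psi x p ≤ |betaHat psi x p| then betaHat psi x p else 0

/-- The estimator `∑_{(j,k) ∈ Γ_n} β̃_{jk} ψ̃_{jk}`. For every sample only finitely many terms
are nonzero, since the decomposition wavelets have compact support. -/
def estimator (γ c c' : ℝ) (psi phit psit : ℝ → ℝ) {n : ℕ} (x : Fin n → ℝ) (y : ℝ) : ℝ :=
  ∑' p : Gam c c' n, betaTilde γ psi x p * wavelet phit psit p y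

end

end WaveletThresholding

open WaveletThresholding

/-! The estimator is a finite wavelet expansion, so its integrated squared error is governed by the
errors of its coefficients. For this the basis must be a frame: the uniform boundedness principle
makes the partial sums of the unconditional expansion `g = ∑ ⟪ψ_p, g⟫ ψ̃_p` uniformly bounded, and
choosing signs by the parallelogram law turns this bound into a Bessel inequality for the `ψ_p`. The
same argument for the adjoint expansion bounds the synthesis by the `ℓ²` norm of the coefficients
(`exists_bessel_synthesis`, `IsBiorthogonalWaveletBasis.exists_frame_bounds`). Neither the vanishing
moments nor the smoothness of the generators matters here, only that they are bounded and compactly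
supported.

It remains to bound the mean squared error of one thresholded mean of `n` independent variables
bounded by `B`, nonzero with probability `F`
(`exists_integral_thresholdedMean_sub_sq_le`). Bernstein's inequality shows that the threshold, even
shrunk by a factor `κ < 1`, dominates the error of the empirical coefficient outside an event of
probability `O(n ^ (-a))`, where `c < a < γ`, provided the variance is not underestimated. The
unbiased variance estimate is, up to the factor `n / (n - 1)`, the empirical second moment about the
true mean minus the squared error of the mean; the first has a sub-Gaussian lower tail and the second
is negligible, and the correction terms in the overestimate are just what is needed
(`le_varBound`). On the good event hard thresholding satisfies an oracle inequality with the square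
of the threshold in place of `log n * σ² / n`.

Since `f` need not be compactly supported there are infinitely many coefficients at each level, so
every remainder must carry a factor `F`, whose sum over a level is bounded. If `F` is at least of
order `log n / n`, such a factor can be inserted for free, and since `ψ` is bounded below on the set
where it does not vanish, `B ^ 2 * F` is of the order of the variance unless `F > 1 / 2`. The latter
happens at low levels only, by the Cauchy-Schwarz inequality for `f`, and this is where `‖f‖₂` enters
the constant. If `F` is smaller, the coefficient is kept only when at least `4 γ log n` of the
observations hit the support of the wavelet, and an exponential moment of their number gives a
remainder proportional to `F`
(`IsBoundedSample.integral_thresholdedMean_sub_sq_le_of_rare`). Summed over the levels up to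
`j₀`, the remainders amount to `2 ^ j₀ * n ^ (-a) * log n / n` up to a constant, and
`2 ^ j₀ ≤ n ^ c * (log n) ^ c'` with `c < a` (`HasBounds.tsum_risk_bound_le`,
`eventually_two_zpow_maxLevel_mul_exp_le`). -/

namespace WaveletThresholding

/-! ### Unconditional biorthogonal expansions in a Hilbert space -/

section Hilbert

variable {H : Type*} [NormedAddCommGroup H] [InnerProductSpace ℝ H] {ι : Type*}

open scoped InnerProductSpace

/-- By the parallelogram law, signs can be chosen one after the other so that the squared norm of
the signed sum is at least the sum of the squared norms. The set `t` collects the plus signs. -/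
lemma exists_signs_sum_norm_sq_le [DecidableEq ι] (x : ι → H) (s : Finset ι) :
    ∃ t ⊆ s, ∑ i ∈ s, ‖x i‖ ^ 2 ≤ ‖∑ i ∈ t, x i - ∑ i ∈ s \ t, x i‖ ^ 2 := by
  induction s using Finset.induction_on with
  | empty => exact ⟨∅, le_rfl, by simp⟩
  | insert a s ha ih =>
    obtain ⟨t, hts, ht⟩ := ih
    have hat : a ∉ t := fun h ↦ ha (hts h)
    set z := ∑ i ∈ t, x i - ∑ i ∈ s \ t, x i with hz
    have hpar := parallelogram_law_with_norm ℝ z (x a)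
    rw [Finset.sum_insert ha]
    by_cases hle : ‖z - x a‖ ≤ ‖z + x a‖
    · refine ⟨insert a t, Finset.insert_subset_insert a hts, ?_⟩
      have h1 : insert a s \ insert a t = s \ t := by
        ext i; simp only [Finset.mem_sdiff, Finset.mem_insert]; grind
      have h2 : ∑ i ∈ insert a t, x i - ∑ i ∈ insert a s \ insert a t, x i = z + x a := by
        rw [h1, Finset.sum_insert hat, hz]; abel
      rw [h2]
      nlinarith [norm_nonneg (z - x a)]
    · refine ⟨t, hts.trans (Finset.subset_insert a s), ?_⟩
      have h1 : insert a s \ t = insert a (s \ t) := by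
        ext i; simp only [Finset.mem_sdiff, Finset.mem_insert]; grind
      have h2 : ∑ i ∈ t, x i - ∑ i ∈ insert a s \ t, x i = z - x a := by
        rw [h1, Finset.sum_insert (by simp [ha]), hz]; abel
      rw [h2]
      nlinarith [norm_nonneg (z + x a)]

/-- If all the finite partial sums of a bilinear expansion are bounded operators with a common
bound, then the analysis coefficients satisfy a Bessel inequality. -/
lemma bessel_of_norm_sum_le (w v : ι → H) {a K : ℝ} (ha : 0 < a) (hv : ∀ i, a ≤ ‖v i‖)
    (hK : ∀ (s : Finset ι) (g : H), ‖∑ i ∈ s, ⟪w i, g⟫_ℝ • v i‖ ≤ K * ‖g‖)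
    (s : Finset ι) (g : H) : ∑ i ∈ s, ⟪w i, g⟫_ℝ ^ 2 ≤ (2 * K / a) ^ 2 * ‖g‖ ^ 2 := by
  classical
  obtain ⟨t, -, ht⟩ := exists_signs_sum_norm_sq_le (fun i ↦ ⟪w i, g⟫_ℝ • v i) s
  have h1 : ‖∑ i ∈ t, ⟪w i, g⟫_ℝ • v i - ∑ i ∈ s \ t, ⟪w i, g⟫_ℝ • v i‖ ≤ 2 * K * ‖g‖ := by
    refine (norm_sub_le _ _).trans ?_
    linarith [hK t g, hK (s \ t) g]
  have h2 : ∑ i ∈ s, (⟪w i, g⟫_ℝ * a) ^ 2 ≤ (2 * K * ‖g‖) ^ 2 := by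
    refine le_trans ?_ (ht.trans (by gcongr))
    refine Finset.sum_le_sum fun i _ ↦ ?_
    rw [norm_smul, mul_pow, mul_pow, Real.norm_eq_abs, sq_abs]
    gcongr
    exact hv i
  simp_rw [mul_pow, ← Finset.sum_mul] at h2
  rw [div_pow, div_mul_eq_mul_div, le_div_iff₀ (by positivity)]
  simpa [mul_pow] using h2

/-- An unconditionally convergent expansion `g = ∑ ⟪w i, g⟫ v i` has uniformly bounded finite
partial sums, by the uniform boundedness principle. -/
lemma exists_norm_sum_le [CompleteSpace H] (w v : ι → H)
    (h : ∀ g : H, HasSum (fun i ↦ ⟪w i, g⟫_ℝ • v i) g) :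
    ∃ K : ℝ, ∀ (s : Finset ι) (g : H), ‖∑ i ∈ s, ⟪w i, g⟫_ℝ • v i‖ ≤ K * ‖g‖ := by
  classical
  let T : Finset ι → H →L[ℝ] H := fun s ↦
    ∑ i ∈ s, (innerSL ℝ (w i)).smulRight (v i)
  have hT : ∀ s g, T s g = ∑ i ∈ s, ⟪w i, g⟫_ℝ • v i := by
    intro s g
    simp [T]
  have hbdd : ∀ g, ∃ C, ∀ s, ‖T s g‖ ≤ C := by
    intro g
    obtain ⟨s₀, hs₀⟩ := (summable_iff_vanishing_norm.1 (h g).summable) 1 one_pos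
    refine ⟨∑ i ∈ s₀, ‖⟪w i, g⟫_ℝ • v i‖ + 1, fun s ↦ ?_⟩
    rw [hT, ← Finset.sum_inter_add_sum_sdiff s s₀]
    refine (norm_add_le _ _).trans (add_le_add ?_ ?_)
    · refine (norm_sum_le _ _).trans ?_
      exact Finset.sum_le_sum_of_subset_of_nonneg Finset.inter_subset_right
        fun _ _ _ ↦ norm_nonneg _
    · exact (hs₀ _ Finset.sdiff_disjoint).le
  obtain ⟨K, hK⟩ := banach_steinhaus hbdd
  exact ⟨K, fun s g ↦ hT s g ▸ (T s).le_of_opNorm_le (hK s) g⟩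

/-- A biorthogonal unconditional expansion whose two systems are bounded away from zero is a frame
expansion: the analysis coefficients satisfy a Bessel inequality, and so does the synthesis. The
second half is the first one applied to the adjoint expansion `g ↦ ∑ ⟪v i, g⟫ w i`. -/
lemma exists_bessel_synthesis [CompleteSpace H] (w v : ι → H)
    (h : ∀ g : H, HasSum (fun i ↦ ⟪w i, g⟫_ℝ • v i) g) {a : ℝ} (ha : 0 < a)
    (hw : ∀ i, a ≤ ‖w i‖) (hv : ∀ i, a ≤ ‖v i‖) :
    ∃ K : ℝ, 0 < K ∧ (∀ (s : Finset ι) (g : H), ∑ i ∈ s, ⟪w i, g⟫_ℝ ^ 2 ≤ K * ‖g‖ ^ 2) ∧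
      ∀ (s : Finset ι) (b : ι → ℝ), ‖∑ i ∈ s, b i • v i‖ ^ 2 ≤ K * ∑ i ∈ s, b i ^ 2 := by
  obtain ⟨K, hK⟩ := exists_norm_sum_le w v h
  have hK' : ∀ (s : Finset ι) (g : H), ‖∑ i ∈ s, ⟪v i, g⟫_ℝ • w i‖ ≤ K * ‖g‖ := by
    intro s g
    set z := ∑ i ∈ s, ⟪v i, g⟫_ℝ • w i with hz
    have h1 : ‖z‖ ^ 2 = ⟪∑ i ∈ s, ⟪w i, z⟫_ℝ • v i, g⟫_ℝ := by
      rw [← real_inner_self_eq_norm_sq]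
      conv_lhs => rw [hz, sum_inner]
      rw [← hz, sum_inner]
      refine Finset.sum_congr rfl fun i _ ↦ ?_
      rw [real_inner_smul_left, real_inner_smul_left, mul_comm]
    have h2 : ‖z‖ ^ 2 ≤ K * ‖z‖ * ‖g‖ := by
      rw [h1]
      exact (real_inner_le_norm _ _).trans (by gcongr; exact hK s z)
    rcases (norm_nonneg z).eq_or_lt with h0 | h0
    · rw [← h0]
      have := (norm_nonneg _).trans (hK ∅ g)
      exact this
    · nlinarith
  refine ⟨(2 * K / a) ^ 2 + 1, by positivity, fun s g ↦ ?_, fun s b ↦ ?_⟩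
  · refine (bessel_of_norm_sum_le w v ha hv hK s g).trans ?_
    nlinarith [sq_nonneg ‖g‖]
  · set y := ∑ i ∈ s, b i • v i with hy
    have h1 : ‖y‖ ^ 2 = ∑ i ∈ s, b i * ⟪v i, y⟫_ℝ := by
      rw [← real_inner_self_eq_norm_sq]
      conv_lhs => rw [hy, sum_inner]
      rw [← hy]
      exact Finset.sum_congr rfl fun i _ ↦ real_inner_smul_left _ _ _
    have h2 := bessel_of_norm_sum_le v w ha hw hK' s y
    have h3 := Finset.sum_mul_sq_le_sq_mul_sq s b (fun i ↦ ⟪v i, y⟫_ℝ)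
    rw [← h1] at h3
    have h4 : 0 ≤ ∑ i ∈ s, b i ^ 2 := Finset.sum_nonneg fun i _ ↦ sq_nonneg _
    have h5 : (‖y‖ ^ 2) ^ 2 ≤ (∑ i ∈ s, b i ^ 2) * ((2 * K / a) ^ 2 * ‖y‖ ^ 2) :=
      h3.trans (by gcongr)
    rcases (sq_nonneg ‖y‖).eq_or_lt with h0 | h0
    · rw [← h0]; positivity
    · have h6 : ‖y‖ ^ 2 ≤ (∑ i ∈ s, b i ^ 2) * (2 * K / a) ^ 2 := by
        by_contra! hcon
        nlinarith [mul_lt_mul_of_pos_right hcon h0]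
      nlinarith

end Hilbert

/-! ### Concentration of means of bounded independent variables -/

lemma two_mul_three_pow_le_factorial (k : ℕ) : 2 * 3 ^ k ≤ (k + 2).factorial := by
  induction k with
  | zero => simp [Nat.factorial]
  | succ k ih =>
    rw [show k + 1 + 2 = (k + 2) + 1 by ring, Nat.factorial_succ, pow_succ]
    nlinarith

/-- The estimate behind Bernstein's inequality, from `(k + 2)! ≥ 2 * 3 ^ k`. -/
lemma exp_le_one_add_add_sq_div {x b : ℝ} (hx : |x| ≤ b) (hb : b < 3) :
    Real.exp x ≤ 1 + x + x ^ 2 / (2 * (1 - b / 3)) := by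
  have hb0 : 0 ≤ b := (abs_nonneg x).trans hx
  have hs := Real.summable_pow_div_factorial x
  have hexp : Real.exp x = 1 + x + ∑' k : ℕ, x ^ (k + 2) / (k + 2).factorial := by
    rw [Real.exp_eq_exp_ℝ, NormedSpace.exp_eq_tsum_div]
    refine (hs.sum_add_tsum_nat_add 2).symm.trans ?_
    simp [Finset.sum_range_succ]
  have hg : HasSum (fun k : ℕ ↦ x ^ 2 / 2 * (b / 3) ^ k) (x ^ 2 / 2 * (1 - b / 3)⁻¹) :=
    (hasSum_geometric_of_lt_one (by positivity) (by linarith)).mul_left _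
  rw [hexp]
  have : ∑' k : ℕ, x ^ (k + 2) / (k + 2).factorial ≤ ∑' k : ℕ, x ^ 2 / 2 * (b / 3) ^ k := by
    refine Summable.tsum_le_tsum (fun k ↦ ?_) ((summable_nat_add_iff 2).2 hs) hg.summable
    have hf : (2 * 3 ^ k : ℝ) ≤ (k + 2).factorial := by
      exact_mod_cast two_mul_three_pow_le_factorial k
    calc x ^ (k + 2) / (k + 2).factorial ≤ |x| ^ (k + 2) / (k + 2).factorial := by
          refine div_le_div_of_nonneg_right ?_ (by positivity)
          rw [← abs_pow]; exact le_abs_self _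
      _ ≤ (x ^ 2 * b ^ k) / (2 * 3 ^ k) := by
          gcongr
          rw [pow_add, sq_abs, mul_comm]
          gcongr
      _ = x ^ 2 / 2 * (b / 3) ^ k := by rw [div_pow]; field_simp
  rw [hg.tsum_eq] at this
  have h3 : x ^ 2 / 2 * (1 - b / 3)⁻¹ = x ^ 2 / (2 * (1 - b / 3)) := by
    rw [div_mul_eq_div_div, div_eq_mul_inv (x ^ 2 / 2)]
  linarith

lemma exp_neg_le_one_sub_add_sq {x : ℝ} (hx : 0 ≤ x) : Real.exp (-x) ≤ 1 - x + x ^ 2 / 2 := by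
  have h1 := Real.quadratic_le_exp_of_nonneg hx
  rw [Real.exp_neg, inv_le_iff_one_le_mul₀ (Real.exp_pos x)]
  have h2 : 0 ≤ 1 - x + x ^ 2 / 2 := by nlinarith [sq_nonneg (x - 1)]
  nlinarith [mul_le_mul_of_nonneg_left h1 h2, pow_nonneg hx 4]

lemma abs_sum_le_of_abs_le {n : ℕ} {y : Fin n → ℝ} {b : ℝ} (hb : ∀ i, |y i| ≤ b) :
    |∑ i, y i| ≤ n * b := by
  refine (Finset.abs_sum_le_sum_abs _ _).trans ?_
  refine (Finset.sum_le_sum fun i _ ↦ hb i).trans ?_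
  simp

section Concentration

variable {Ω : Type*} [MeasurableSpace Ω] {P : Measure Ω} [IsProbabilityMeasure P]
  {n : ℕ} {D : Fin n → Ω → ℝ}

lemma integrable_of_abs_le {g : Ω → ℝ} {C : ℝ} (hg : AEMeasurable g P) (h : ∀ ω, |g ω| ≤ C) :
    Integrable g P :=
  Integrable.of_bound hg.aestronglyMeasurable C (ae_of_all _ h)

lemma integrable_exp_of_abs_le {g : Ω → ℝ} {C : ℝ} (t : ℝ) (hg : AEMeasurable g P)
    (h : ∀ ω, |g ω| ≤ C) : Integrable (fun ω ↦ Real.exp (t * g ω)) P := by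
  refine integrable_of_abs_le (C := Real.exp (|t| * C)) (by fun_prop) fun ω ↦ ?_
  rw [Real.abs_exp, Real.exp_le_exp]
  exact (le_abs_self _).trans (by rw [abs_mul]; gcongr; exact h ω)

lemma integral_quadratic {g : Ω → ℝ} {C : ℝ} (hg : AEMeasurable g P) (h : ∀ ω, |g ω| ≤ C)
    (a b c : ℝ) :
    ∫ ω, (a + b * g ω + c * g ω ^ 2) ∂P = a + b * ∫ ω, g ω ∂P + c * ∫ ω, g ω ^ 2 ∂P := by
  have hi : Integrable g P := integrable_of_abs_le hg h
  have hi2 : Integrable (fun ω ↦ g ω ^ 2) P :=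
    integrable_of_abs_le (C := C ^ 2) (by fun_prop) fun ω ↦ by
      rw [abs_pow]; exact pow_le_pow_left₀ (abs_nonneg _) (h ω) 2
  have h1 : Integrable (fun ω ↦ a + b * g ω) P := (integrable_const _).add (hi.const_mul _)
  rw [integral_add h1 (hi2.const_mul _), integral_add (integrable_const _) (hi.const_mul _),
    integral_const_mul, integral_const_mul]
  simp

/-- Chernoff's bound for a sum of independent bounded variables with a common bound on their
moment generating functions. -/
lemma measureReal_le_sum_le_exp (hD : iIndepFun D P) (hm : ∀ i, AEMeasurable (D i) P) {b : ℝ}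
    (hb : ∀ i ω, |D i ω| ≤ b) {lam c t : ℝ} (hlam : 0 ≤ lam)
    (hmgf : ∀ i, mgf (D i) P lam ≤ Real.exp c) :
    P.real {ω | t ≤ ∑ i, D i ω} ≤ Real.exp (n * c - lam * t) := by
  have hint : Integrable (fun ω ↦ Real.exp (lam * (∑ i, D i) ω)) P := by
    refine integrable_exp_of_abs_le (C := n * b) _ (by fun_prop) fun ω ↦ ?_
    rw [Finset.sum_apply]
    exact abs_sum_le_of_abs_le fun i ↦ hb i ω
  have h1 := measure_ge_le_exp_mul_mgf (X := ∑ i, D i) t hlam hint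
  rw [hD.mgf_sum₀ hm] at h1
  simp only [Finset.sum_apply] at h1
  refine h1.trans ?_
  calc Real.exp (-lam * t) * ∏ i, mgf (D i) P lam
      ≤ Real.exp (-lam * t) * ∏ _i : Fin n, Real.exp c := by
        gcongr with i
        · exact fun i _ ↦ mgf_nonneg
        · exact hmgf i
    _ = Real.exp (n * c - lam * t) := by
        rw [Finset.prod_const, Finset.card_univ, Fintype.card_fin, ← Real.exp_nat_mul,
          ← Real.exp_add]
        ring_nf

lemma mgf_le_exp_of_abs_le {g : Ω → ℝ} {b v lam : ℝ} (hg : AEMeasurable g P)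
    (hb : ∀ ω, |g ω| ≤ b) (h0 : ∫ ω, g ω ∂P = 0) (hv : ∫ ω, g ω ^ 2 ∂P = v)
    (hlam : 0 ≤ lam) (hlb : lam * b < 3) :
    mgf g P lam ≤ Real.exp (lam ^ 2 * v / (2 * (1 - lam * b / 3))) := by
  have hi : Integrable g P := integrable_of_abs_le hg hb
  have hi2 : Integrable (fun ω ↦ g ω ^ 2) P :=
    integrable_of_abs_le (C := b ^ 2) (by fun_prop) fun ω ↦ by
      rw [abs_pow]; exact pow_le_pow_left₀ (abs_nonneg _) (hb ω) 2
  have h1 : mgf g P lam ≤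
      ∫ ω, (1 + lam * g ω + lam ^ 2 / (2 * (1 - lam * b / 3)) * g ω ^ 2) ∂P := by
    refine integral_mono (integrable_exp_of_abs_le lam hg hb)
      (((integrable_const _).add (hi.const_mul _)).add (hi2.const_mul _)) fun ω ↦ ?_
    have := exp_le_one_add_add_sq_div (x := lam * g ω) (b := lam * b)
      (by rw [abs_mul, abs_of_nonneg hlam]; gcongr; exact hb ω) hlb
    refine this.trans (le_of_eq ?_)
    rw [mul_pow]
    ring
  rw [integral_quadratic hg hb, h0, hv] at h1
  refine h1.trans ?_
  have := Real.add_one_le_exp (lam ^ 2 * v / (2 * (1 - lam * b / 3)))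
  refine le_trans (le_of_eq ?_) this
  ring

/-- **Bernstein's inequality**, upper tail. -/
theorem bernstein_upper (hD : iIndepFun D P) (hm : ∀ i, AEMeasurable (D i) P) {b v u : ℝ}
    (hb0 : 0 < b) (hb : ∀ i ω, |D i ω| ≤ b) (h0 : ∀ i, ∫ ω, D i ω ∂P = 0)
    (hv : ∀ i, ∫ ω, D i ω ^ 2 ∂P = v) (hn : 0 < n) (hu : 0 < u) :
    P.real {ω | √(2 * u * v / n) + b * u / (3 * n) < (1 / (n : ℝ)) * ∑ i, D i ω}
      ≤ Real.exp (-u) := by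
  have hn' : (0 : ℝ) < n := by exact_mod_cast hn
  have hv0 : 0 ≤ v := by
    rw [← hv ⟨0, hn⟩]; exact integral_nonneg fun ω ↦ sq_nonneg _
  rcases hv0.eq_or_lt with hv0 | hv0
  · -- a vanishing variance makes every variable almost surely zero
    have hz : ∀ i, ∀ᵐ ω ∂P, D i ω = 0 := by
      intro i
      have hi2 : Integrable (fun ω ↦ D i ω ^ 2) P :=
        integrable_of_abs_le (C := b ^ 2) (by have := hm i; fun_prop) fun ω ↦ by
          rw [abs_pow]; exact pow_le_pow_left₀ (abs_nonneg _) (hb i ω) 2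
      have := (integral_eq_zero_iff_of_nonneg (fun ω ↦ sq_nonneg (D i ω)) hi2).1
        ((hv i).trans hv0.symm)
      filter_upwards [this] with ω hω
      simpa using hω
    have : P.real {ω | √(2 * u * v / n) + b * u / (3 * n) < (1 / (n : ℝ)) * ∑ i, D i ω} = 0 := by
      rw [measureReal_eq_zero_iff]
      refine measure_mono_null ?_ (ae_all_iff.2 hz)
      intro ω hω hcon
      replace hcon : ∀ i, D i ω = 0 := hcon
      simp only [Set.mem_ofPred_eq, hcon, Finset.sum_const_zero, mul_zero] at hω
      have : 0 ≤ √(2 * u * v / n) + b * u / (3 * n) := by positivity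
      linarith
    rw [this]
    positivity
  · set s := √(2 * u / (n * v))
    have hs2 : s ^ 2 = 2 * u / (n * v) := Real.sq_sqrt (by positivity)
    have hs0 : 0 < s := Real.sqrt_pos.2 (by positivity)
    have hsv : √(2 * u * v / n) = s * v := by
      rw [Real.sqrt_eq_iff_mul_self_eq (by positivity) (by positivity), ← sq, mul_pow, hs2]
      field_simp
    set lam := s / (1 + s * b / 3) with hlam
    have hden : 0 < 1 + s * b / 3 := by positivity
    have hlb : lam * b < 3 := by
      rw [hlam, div_mul_eq_mul_div, div_lt_iff₀ hden]; nlinarith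
    have h1 := measureReal_le_sum_le_exp (t := n * (s * v + b * u / (3 * n))) hD hm hb
      (by positivity) fun i ↦ mgf_le_exp_of_abs_le (hm i) (hb i) (h0 i) (hv i) (by positivity) hlb
    refine (measureReal_mono ?_).trans (h1.trans (le_of_eq ?_))
    · intro ω hω
      simp only [Set.mem_ofPred_eq, hsv] at hω ⊢
      rw [one_div, ← div_eq_inv_mul, lt_div_iff₀ hn'] at hω
      linarith
    · congr 1
      have e1 : 1 - lam * b / 3 = 1 / (1 + s * b / 3) := by
        rw [hlam]; field_simp; ring
      rw [e1]
      have e2 : n * (lam ^ 2 * v / (2 * (1 / (1 + s * b / 3))))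
          = n * s ^ 2 * v / 2 / (1 + s * b / 3) := by
        rw [hlam]; field_simp
      have e3 : lam * (n * (s * v + b * u / (3 * n)))
          = (n * s ^ 2 * v + s * b * u / 3) / (1 + s * b / 3) := by
        rw [hlam]; field_simp
      have e4 : n * s ^ 2 * v = 2 * u := by rw [hs2]; field_simp
      rw [e2, e3, e4]
      field_simp
      ring

/-- **Bernstein's inequality**, two-sided. -/
theorem bernstein_abs (hD : iIndepFun D P) (hm : ∀ i, AEMeasurable (D i) P) {b v u : ℝ}
    (hb0 : 0 < b) (hb : ∀ i ω, |D i ω| ≤ b) (h0 : ∀ i, ∫ ω, D i ω ∂P = 0)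
    (hv : ∀ i, ∫ ω, D i ω ^ 2 ∂P = v) (hn : 0 < n) (hu : 0 < u) :
    P.real {ω | √(2 * u * v / n) + b * u / (3 * n) < |(1 / (n : ℝ)) * ∑ i, D i ω|}
      ≤ 2 * Real.exp (-u) := by
  have h1 := bernstein_upper hD hm hb0 hb h0 hv hn hu
  have h2 := bernstein_upper (D := fun i ω ↦ -D i ω)
    (hD.comp (fun _ x ↦ -x) fun _ ↦ measurable_neg) (fun i ↦ (hm i).neg) hb0
    (fun i ω ↦ by rw [abs_neg]; exact hb i ω)
    (fun i ↦ by rw [integral_neg, h0, neg_zero]) (fun i ↦ by simpa using hv i) hn hu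
  refine (measureReal_mono (s₂ := {ω | √(2 * u * v / n) + b * u / (3 * n) <
    (1 / (n : ℝ)) * ∑ i, D i ω} ∪ {ω | √(2 * u * v / n) + b * u / (3 * n) <
    (1 / (n : ℝ)) * ∑ i, -D i ω}) ?_).trans ((measureReal_union_le _ _).trans (by linarith))
  intro ω hω
  simp only [Set.mem_ofPred_eq, Set.mem_union, Finset.sum_neg_distrib, mul_neg] at hω ⊢
  exact lt_abs.1 hω

/-- Nonnegative variables have a sub-Gaussian lower tail, with the second moment as proxy. -/
theorem lower_tail_of_nonneg {V : Fin n → Ω → ℝ} (hV : iIndepFun V P)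
    (hm : ∀ i, AEMeasurable (V i) P) {b v w u : ℝ} (hV0 : ∀ i ω, 0 ≤ V i ω)
    (hb : ∀ i ω, V i ω ≤ b) (hv : ∀ i, ∫ ω, V i ω ∂P = v) (hw0 : 0 < w)
    (hw : ∀ i, ∫ ω, V i ω ^ 2 ∂P ≤ w) (hn : 0 < n) (hu : 0 < u) :
    P.real {ω | (1 / (n : ℝ)) * ∑ i, V i ω < v - √(2 * u * w / n)} ≤ Real.exp (-u) := by
  have hn' : (0 : ℝ) < n := by exact_mod_cast hn
  set t := √(2 * u * w / n)
  have ht2 : t ^ 2 = 2 * u * w / n := Real.sq_sqrt (by positivity)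
  have hbV : ∀ i ω, |(-V i ω)| ≤ b := fun i ω ↦ by
    rw [abs_neg, abs_of_nonneg (hV0 i ω)]; exact hb i ω
  have hlam : 0 ≤ t / w := by positivity
  have h1 := measureReal_le_sum_le_exp (D := fun i ω ↦ -V i ω) (t := -(n * (v - t)))
    (c := -(t / w) * v + (t / w) ^ 2 * w / 2)
    (hV.comp (fun _ x ↦ -x) fun _ ↦ measurable_neg) (fun i ↦ (hm i).neg) hbV hlam ?_
  · refine (measureReal_mono ?_).trans (h1.trans (le_of_eq ?_))
    · intro ω hω
      simp only [Set.mem_ofPred_eq, Finset.sum_neg_distrib] at hω ⊢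
      rw [one_div, ← div_eq_inv_mul, div_lt_iff₀ hn'] at hω
      linarith
    · congr 1
      have : n * (-(t / w) * v + (t / w) ^ 2 * w / 2) - t / w * -(n * (v - t))
          = - (n * t ^ 2 / (2 * w)) := by field_simp; ring
      rw [this, ht2]
      field_simp
  · intro i
    have hi : Integrable (V i) P := integrable_of_abs_le (hm i) fun ω ↦ by
      rw [← abs_neg]; exact hbV i ω
    have hi2 : Integrable (fun ω ↦ V i ω ^ 2) P :=
      integrable_of_abs_le (C := b ^ 2) (by have := hm i; fun_prop) fun ω ↦ by
        rw [abs_pow]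
        exact pow_le_pow_left₀ (abs_nonneg _) (by rw [← abs_neg]; exact hbV i ω) 2
    have h2 : mgf (fun ω ↦ -V i ω) P (t / w) ≤
        ∫ ω, (1 + -(t / w) * V i ω + (t / w) ^ 2 / 2 * V i ω ^ 2) ∂P := by
      refine integral_mono (integrable_exp_of_abs_le _ (hm i).neg (hbV i))
        (((integrable_const _).add (hi.const_mul _)).add (hi2.const_mul _)) fun ω ↦ ?_
      have := exp_neg_le_one_sub_add_sq (mul_nonneg hlam (hV0 i ω))
      simp only [mul_neg]
      refine this.trans (le_of_eq ?_)
      ring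
    rw [integral_quadratic (hm i) (fun ω ↦ by rw [← abs_neg]; exact hbV i ω), hv] at h2
    refine h2.trans (le_trans ?_ (Real.add_one_le_exp _))
    have := mul_le_mul_of_nonneg_left (hw i) (by positivity : 0 ≤ (t / w) ^ 2 / 2)
    linarith

end Concentration

/-! ### Hard thresholding of a sample mean: deterministic estimates -/

/-- The mean of a sample `y`. -/
noncomputable def sampleMean {n : ℕ} (y : Fin n → ℝ) : ℝ := (1 / (n : ℝ)) * ∑ i, y i

/-- The unbiased sample variance, written as a sum over pairs. -/
noncomputable def sampleVar {n : ℕ} (y : Fin n → ℝ) : ℝ :=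
  (1 / ((n : ℝ) * ((n : ℝ) - 1))) * ∑ i, ∑ l ∈ Finset.Iio i, (y i - y l) ^ 2

/-- The overestimate of the variance for a sample bounded by `B`. -/
noncomputable def varBound (γ B : ℝ) {n : ℕ} (y : Fin n → ℝ) : ℝ :=
  sampleVar y + 2 * B * √(2 * γ * sampleVar y * (Real.log n / n))
    + 8 * γ * B ^ 2 * (Real.log n / n)

/-- The data-driven threshold for a sample bounded by `B`. -/
noncomputable def threshold (γ B : ℝ) {n : ℕ} (y : Fin n → ℝ) : ℝ :=
  √(2 * γ * varBound γ B y * (Real.log n / n)) + 2 * B * γ * Real.log n / (3 * n)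

/-- The sample mean, hard-thresholded at the data-driven level. -/
noncomputable def thresholdedMean (γ B : ℝ) {n : ℕ} (y : Fin n → ℝ) : ℝ :=
  if threshold γ B y ≤ |sampleMean y| then sampleMean y else 0

lemma two_mul_sum_sum_Iio {n : ℕ} (y : Fin n → ℝ) :
    2 * ∑ i, ∑ l ∈ Finset.Iio i, (y i - y l) ^ 2 = ∑ i, ∑ l, (y i - y l) ^ 2 := by
  have h1 : ∀ i, ∑ l ∈ Finset.Iio i, (y i - y l) ^ 2
      = ∑ l, if l < i then (y i - y l) ^ 2 else 0 := by
    intro i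
    rw [← Finset.sum_filter, Finset.filter_gt_eq_Iio]
  simp_rw [h1]
  have h2 : ∑ i, ∑ l, (if l < i then (y i - y l) ^ 2 else 0)
      = ∑ i, ∑ l, (if i < l then (y i - y l) ^ 2 else 0) := by
    rw [Finset.sum_comm]
    refine Finset.sum_congr rfl fun i _ ↦ Finset.sum_congr rfl fun l _ ↦ ?_
    split_ifs <;> ring
  rw [two_mul]
  nth_rw 2 [h2]
  rw [← Finset.sum_add_distrib]
  refine Finset.sum_congr rfl fun i _ ↦ ?_
  rw [← Finset.sum_add_distrib]
  refine Finset.sum_congr rfl fun l _ ↦ ?_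
  rcases lt_trichotomy l i with h | h | h
  · simp [h, h.not_gt]
  · simp [h]
  · simp [h, h.not_gt]

/-- Centring at any point `b` expresses the sample variance by the empirical second moment about
`b` and the deviation of the sample mean from `b`. -/
lemma sampleVar_eq {n : ℕ} (hn : 2 ≤ n) (y : Fin n → ℝ) (b : ℝ) :
    sampleVar y = n / (n - 1) *
      ((1 / (n : ℝ)) * ∑ i, (y i - b) ^ 2 - (sampleMean y - b) ^ 2) := by
  have hn' : (2 : ℝ) ≤ n := by exact_mod_cast hn
  have h0 : (n : ℝ) ≠ 0 := by positivity
  have h1 : (n : ℝ) - 1 ≠ 0 := by linarith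
  have h2 := two_mul_sum_sum_Iio y
  have h3 : ∑ i, ∑ l, (y i - y l) ^ 2 = 2 * (n * ∑ i, y i ^ 2 - (∑ i, y i) ^ 2) := by
    simp_rw [sub_sq, Finset.sum_add_distrib, Finset.sum_sub_distrib, Finset.sum_const,
      ← Finset.mul_sum, mul_assoc, ← Finset.mul_sum, ← Finset.sum_mul]
    simp only [Finset.card_univ, Fintype.card_fin, nsmul_eq_mul, ← Finset.mul_sum]
    ring
  have h4 : ∑ i, (y i - b) ^ 2 = ∑ i, y i ^ 2 - 2 * b * ∑ i, y i + n * b ^ 2 := by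
    simp_rw [sub_sq, Finset.sum_add_distrib, Finset.sum_sub_distrib, Finset.sum_const,
      mul_assoc, ← Finset.mul_sum, ← Finset.sum_mul]
    simp only [Finset.card_univ, Fintype.card_fin, nsmul_eq_mul]
    ring
  rw [h3] at h2
  have h5 : ∑ i, ∑ l ∈ Finset.Iio i, (y i - y l) ^ 2 = n * ∑ i, y i ^ 2 - (∑ i, y i) ^ 2 := by
    linarith
  rw [sampleVar, h5, h4, sampleMean]
  field_simp
  ring

lemma sampleVar_nonneg {n : ℕ} (y : Fin n → ℝ) : 0 ≤ sampleVar y := by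
  rw [sampleVar]
  rcases Nat.eq_zero_or_pos n with rfl | h
  · simp
  · have : (1 : ℝ) ≤ n := by exact_mod_cast h
    exact mul_nonneg (one_div_nonneg.2 (mul_nonneg (by linarith) (by linarith)))
      (Finset.sum_nonneg fun i _ ↦ Finset.sum_nonneg fun l _ ↦ sq_nonneg _)

lemma sampleVar_le {n : ℕ} (hn : 2 ≤ n) (y : Fin n → ℝ) (b : ℝ) :
    sampleVar y ≤ 2 * ((1 / (n : ℝ)) * ∑ i, (y i - b) ^ 2) := by
  have hn' : (2 : ℝ) ≤ n := by exact_mod_cast hn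
  rw [sampleVar_eq hn y b]
  have h1 : (n : ℝ) / (n - 1) ≤ 2 := by rw [div_le_iff₀ (by linarith)]; linarith
  have h2 : 0 ≤ (n : ℝ) / (n - 1) := div_nonneg (by linarith) (by linarith)
  have h3 : 0 ≤ (1 / (n : ℝ)) * ∑ i, (y i - b) ^ 2 :=
    mul_nonneg (by positivity) (Finset.sum_nonneg fun i _ ↦ sq_nonneg _)
  nlinarith [sq_nonneg (sampleMean y - b), mul_nonneg h2 (sq_nonneg (sampleMean y - b))]

lemma le_sampleVar {n : ℕ} (hn : 2 ≤ n) (y : Fin n → ℝ) (b : ℝ) :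
    (1 / (n : ℝ)) * ∑ i, (y i - b) ^ 2 - 2 * (sampleMean y - b) ^ 2 ≤ sampleVar y := by
  have hn' : (2 : ℝ) ≤ n := by exact_mod_cast hn
  rw [sampleVar_eq hn y b]
  have h1 : (n : ℝ) / (n - 1) ≤ 2 := by rw [div_le_iff₀ (by linarith)]; linarith
  have h2 : 1 ≤ (n : ℝ) / (n - 1) := by rw [le_div_iff₀ (by linarith)]; linarith
  have h3 : 0 ≤ (1 / (n : ℝ)) * ∑ i, (y i - b) ^ 2 :=
    mul_nonneg (by positivity) (Finset.sum_nonneg fun i _ ↦ sq_nonneg _)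
  nlinarith [sq_nonneg (sampleMean y - b),
    mul_le_mul_of_nonneg_right h1 (sq_nonneg (sampleMean y - b))]

/-- If `S` falls short of `v` by at most about `2 √(q v)`, then `S + 2 √(q S) + 4 q` is essentially
at least `v`. This is what the two correction terms in the variance overestimate are for. -/
lemma one_sub_mul_le_of_sub_sqrt_le {q S v ε : ℝ} (hq : 0 ≤ q) (hS : 0 ≤ S) (hv : 0 ≤ v)
    (hε : 0 ≤ ε) (hε1 : ε ≤ 1)
    (h : v - 2 * (√q * √v) - ε ^ 2 * (v + q) / 2 ≤ S) :
    (1 - 2 * ε) * v ≤ S + 2 * (√q * √S) + 4 * q := by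
  have ea := Real.sq_sqrt hq
  have et := Real.sq_sqrt hS
  have es := Real.sq_sqrt hv
  set a := √q
  set t := √S
  set s := √v
  have a0 : 0 ≤ a := Real.sqrt_nonneg _
  have t0 : 0 ≤ t := Real.sqrt_nonneg _
  have s0 : 0 ≤ s := Real.sqrt_nonneg _
  rw [← ea, ← et, ← es] at *
  rcases le_total s a with hsa | hsa
  · have : s ^ 2 ≤ a ^ 2 := pow_le_pow_left₀ s0 hsa 2
    nlinarith [mul_nonneg a0 t0, mul_nonneg hε (sq_nonneg s), sq_nonneg t]
  · set w := √(t ^ 2 + a ^ 2)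
    have w0 : 0 ≤ w := Real.sqrt_nonneg _
    have ew : w ^ 2 = t ^ 2 + a ^ 2 := Real.sq_sqrt (by positivity)
    have hwt : w ≤ t + a := by
      refine Real.sqrt_le_iff.2 ⟨by positivity, ?_⟩
      nlinarith [mul_nonneg a0 t0]
    have h1 : a ^ 2 ≤ s ^ 2 := pow_le_pow_left₀ a0 hsa 2
    have h2 : (s - a) ^ 2 ≤ (w + ε * s) ^ 2 := by
      nlinarith [mul_le_mul_of_nonneg_left h1 (sq_nonneg ε),
        mul_nonneg w0 (mul_nonneg hε s0)]
    have h3 : s - a ≤ w + ε * s := (abs_le_of_sq_le_sq' h2 (by positivity)).2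
    have h4 : (1 - ε) * s ≤ a + w := by linarith
    have h5 : ((1 - ε) * s) ^ 2 ≤ (a + w) ^ 2 :=
      pow_le_pow_left₀ (mul_nonneg (by linarith) s0) h4 2
    nlinarith [mul_le_mul_of_nonneg_left hwt a0, mul_nonneg (sq_nonneg ε) (sq_nonneg s)]

lemma sqrt_sq_mul {a : ℝ} (ha : 0 ≤ a) (x : ℝ) : √(a ^ 2 * x) = a * √x := by
  rw [Real.sqrt_mul (sq_nonneg a), Real.sqrt_sq ha]

lemma add_sq_le_two_mul (x y : ℝ) : (x + y) ^ 2 ≤ 2 * x ^ 2 + 2 * y ^ 2 := by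
  nlinarith [sq_nonneg (x - y)]

/-- The variance overestimate dominates the true variance as soon as the empirical second moment
and the empirical mean are not too far from their expectations. -/
lemma le_varBound {n : ℕ} (hn : 2 ≤ n) (y : Fin n → ℝ) {γ B b v ε : ℝ} (hγ : 0 ≤ γ) (hB : 0 ≤ B)
    (hv : 0 ≤ v) (hε : 0 ≤ ε) (hε1 : ε ≤ 1)
    (hl : γ * (Real.log n / n) ≤ ε ^ 2 / 16)
    (h1 : v - √(2 * γ * (4 * B ^ 2 * v) * (Real.log n / n)) ≤
      (1 / (n : ℝ)) * ∑ i, (y i - b) ^ 2)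
    (h2 : |sampleMean y - b| ≤
      √(2 * γ * v * (Real.log n / n)) + 2 * B * γ * (Real.log n / n) / 3) :
    (1 - 2 * ε) * v ≤ varBound γ B y := by
  set l := Real.log n / n with hldef
  have l0 : 0 ≤ l := div_nonneg (Real.log_natCast_nonneg n) (by positivity)
  set q := 2 * γ * B ^ 2 * l with hq
  have q0 : 0 ≤ q := by positivity
  have S0 := sampleVar_nonneg y
  have e1 : √(2 * γ * (4 * B ^ 2 * v) * l) = 2 * (√q * √v) := by
    rw [← Real.sqrt_mul q0, show 2 * γ * (4 * B ^ 2 * v) * l = 2 ^ 2 * (q * v) by rw [hq]; ring,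
      sqrt_sq_mul (by norm_num)]
  have e2 : 2 * B * √(2 * γ * sampleVar y * l) = 2 * (√q * √(sampleVar y)) := by
    rw [← Real.sqrt_mul q0, show q * sampleVar y = B ^ 2 * (2 * γ * sampleVar y * l) by
      rw [hq]; ring, sqrt_sq_mul hB]
    ring
  have h3 : (sampleMean y - b) ^ 2 ≤ 4 * (γ * l) * v + 4 / 9 * (γ * l) * q := by
    have := pow_le_pow_left₀ (abs_nonneg _) h2 2
    rw [sq_abs] at this
    refine this.trans ((add_sq_le_two_mul _ _).trans (le_of_eq ?_))
    rw [Real.sq_sqrt (by positivity), hq]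
    ring
  have h4 := le_sampleVar hn y b
  have h5 := one_sub_mul_le_of_sub_sqrt_le q0 S0 hv hε hε1 (by
    rw [e1] at h1
    nlinarith [mul_le_mul_of_nonneg_right hl hv, mul_le_mul_of_nonneg_right hl q0,
      mul_nonneg (sq_nonneg ε) q0])
  rw [varBound, ← hldef, e2]
  refine h5.trans (le_of_eq ?_)
  rw [hq]
  ring

lemma threshold_nonneg {n : ℕ} (y : Fin n → ℝ) {γ B : ℝ} (hγ : 0 ≤ γ) (hB : 0 ≤ B) :
    0 ≤ threshold γ B y := by
  have := Real.log_natCast_nonneg n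
  rw [threshold]
  positivity

lemma varBound_nonneg {n : ℕ} (y : Fin n → ℝ) {γ B : ℝ} (hγ : 0 ≤ γ) (hB : 0 ≤ B) :
    0 ≤ varBound γ B y := by
  have := Real.log_natCast_nonneg n
  have := sampleVar_nonneg y
  rw [varBound]
  positivity

/-- The threshold is of the order of the ideal one, in terms of the empirical second moment. -/
lemma threshold_sq_le {n : ℕ} (hn : 2 ≤ n) (y : Fin n → ℝ) (b : ℝ) {γ B : ℝ} (hγ : 0 ≤ γ)
    (hB : 0 ≤ B) :
    threshold γ B y ^ 2 ≤ 16 * γ * (Real.log n / n) * ((1 / (n : ℝ)) * ∑ i, (y i - b) ^ 2)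
      + 41 * γ ^ 2 * B ^ 2 * (Real.log n / n) ^ 2 := by
  have S0 := sampleVar_nonneg y
  have V0 := varBound_nonneg y hγ hB
  have hS := sampleVar_le hn y b
  set s := (1 / (n : ℝ)) * ∑ i, (y i - b) ^ 2
  have e0 : 2 * B * γ * Real.log n / (3 * n) = 2 * B * γ * (Real.log n / n) / 3 := by
    rw [mul_comm (3 : ℝ) n, mul_div_assoc, ← div_div]; ring
  rw [threshold, e0]
  have hV : varBound γ B y ≤ 4 * s + 10 * γ * B ^ 2 * (Real.log n / n) := by
    have l0 : 0 ≤ Real.log n / n := div_nonneg (Real.log_natCast_nonneg n) (by positivity)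
    rw [varBound]
    set l := Real.log n / n
    have : 2 * B * √(2 * γ * sampleVar y * l) ≤ sampleVar y + 2 * γ * B ^ 2 * l := by
      have e1 : B * √(2 * γ * sampleVar y * l) = √(2 * γ * B ^ 2 * l) * √(sampleVar y) := by
        rw [← Real.sqrt_mul (by positivity), show 2 * γ * B ^ 2 * l * sampleVar y
          = B ^ 2 * (2 * γ * sampleVar y * l) by ring, sqrt_sq_mul hB]
      nlinarith [sq_nonneg (√(2 * γ * B ^ 2 * l) - √(sampleVar y)), Real.sq_sqrt S0,
        Real.sq_sqrt (by positivity : 0 ≤ 2 * γ * B ^ 2 * l)]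
    linarith
  have l0 : 0 ≤ Real.log n / n := div_nonneg (Real.log_natCast_nonneg n) (by positivity)
  set l := Real.log n / n
  refine (add_sq_le_two_mul _ _).trans ?_
  rw [Real.sq_sqrt (by positivity)]
  have h1 : 0 ≤ γ * l := by positivity
  have h2 : 0 ≤ γ ^ 2 * B ^ 2 * l ^ 2 := by positivity
  nlinarith [mul_le_mul_of_nonneg_left hV h1]

/-- A hard-thresholded estimate whose error is a fraction `κ < 1` of the threshold obeys the oracle
bound `min (b ^ 2) (η ^ 2)` up to a constant. -/
lemma hardThreshold_sub_sq_le {x b η κ : ℝ} (hη : 0 ≤ η) (hκ : 0 ≤ κ) (hκ1 : κ < 1)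
    (h : |x - b| ≤ κ * η) :
    ((if η ≤ |x| then x else 0) - b) ^ 2 ≤ 4 / (1 - κ) ^ 2 * min (b ^ 2) (η ^ 2) := by
  have hd : 0 < 1 - κ := by linarith
  have hd1 : (1 - κ) ^ 2 ≤ 1 := by nlinarith
  rw [div_mul_eq_mul_div, le_div_iff₀ (by positivity), mul_min_of_nonneg _ _ (by norm_num)]
  have hx := abs_sub_abs_le_abs_sub x b
  have hx' := abs_sub_abs_le_abs_sub b x
  rw [abs_sub_comm b x] at hx'
  split_ifs with hc
  · have h1 : (1 - κ) * η ≤ |b| := by linarith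
    have h2 : |x - b| * (1 - κ) ≤ |b| := by
      nlinarith [abs_nonneg (x - b), mul_le_mul_of_nonneg_right h hd.le, mul_nonneg hd.le hη]
    have h3 : (x - b) ^ 2 * (1 - κ) ^ 2 ≤ b ^ 2 := by
      rw [← sq_abs (x - b), ← mul_pow, ← sq_abs b]
      exact pow_le_pow_left₀ (mul_nonneg (abs_nonneg _) hd.le) h2 2
    have h4 : (x - b) ^ 2 ≤ η ^ 2 := by
      rw [← sq_abs (x - b)]
      exact pow_le_pow_left₀ (abs_nonneg _) (h.trans (by nlinarith)) 2
    refine le_min (by nlinarith [sq_nonneg b]) ?_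
    nlinarith [sq_nonneg (x - b), sq_nonneg η]
  · have h1 : |b| ≤ 2 * η := by push Not at hc; nlinarith
    have h2 : b ^ 2 ≤ 4 * η ^ 2 := by
      rw [← sq_abs b]
      exact (pow_le_pow_left₀ (abs_nonneg _) h1 2).trans (le_of_eq (by ring))
    rw [zero_sub, neg_sq]
    refine le_min (by nlinarith [sq_nonneg b]) ?_
    nlinarith [sq_nonneg b]

lemma measurable_sampleMean {n : ℕ} : Measurable (sampleMean : (Fin n → ℝ) → ℝ) := by
  unfold sampleMean; fun_prop

lemma measurable_threshold {n : ℕ} (γ B : ℝ) :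
    Measurable (threshold γ B : (Fin n → ℝ) → ℝ) := by
  unfold threshold varBound sampleVar; fun_prop

lemma measurable_thresholdedMean {n : ℕ} (γ B : ℝ) :
    Measurable (thresholdedMean γ B : (Fin n → ℝ) → ℝ) := by
  unfold thresholdedMean
  exact Measurable.ite (measurableSet_le (measurable_threshold γ B) measurable_sampleMean.abs)
    measurable_sampleMean measurable_const

/-! ### Risk of one thresholded mean -/

/-- Independent variables `Y i` bounded by `B` with common mean `β`, variance `v` and
probability `F` of being nonzero. -/
structure IsBoundedSample {Ω : Type*} [MeasurableSpace Ω] (P : Measure Ω) {n : ℕ}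
    (Y : Fin n → Ω → ℝ) (B β v F : ℝ) : Prop where
  indep : iIndepFun Y P
  meas : ∀ i, Measurable (Y i)
  bound : ∀ i ω, |Y i ω| ≤ B
  mean : ∀ i, ∫ ω, Y i ω ∂P = β
  var : ∀ i, ∫ ω, (Y i ω - β) ^ 2 ∂P = v
  prob : ∀ i, P.real {ω | Y i ω ≠ 0} = F

section Risk

variable {Ω : Type*} [MeasurableSpace Ω] {P : Measure Ω}
  {n : ℕ} {Y : Fin n → Ω → ℝ} {B β v F : ℝ}

namespace IsBoundedSample

lemma variance_nonneg (h : IsBoundedSample P Y B β v F) (hn : 0 < n) : 0 ≤ v := by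
  rw [← h.var ⟨0, hn⟩]; exact integral_nonneg fun ω ↦ sq_nonneg _

lemma measurable_pi (h : IsBoundedSample P Y B β v F) : Measurable fun ω i ↦ Y i ω :=
  measurable_pi_lambda _ h.meas

lemma prob_nonneg (h : IsBoundedSample P Y B β v F) (hn : 0 < n) : 0 ≤ F := by
  rw [← h.prob ⟨0, hn⟩]; exact measureReal_nonneg

lemma measurableSet_ne (h : IsBoundedSample P Y B β v F) (i : Fin n) :
    MeasurableSet {ω | Y i ω ≠ 0} :=
  (h.meas i (measurableSet_singleton 0)).compl

variable [IsProbabilityMeasure P]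

lemma abs_le_mul (h : IsBoundedSample P Y B β v F) (hn : 0 < n) : |β| ≤ B * F := by
  let i : Fin n := ⟨0, hn⟩
  have hi : Integrable (fun ω ↦ B * {ω | Y i ω ≠ 0}.indicator (fun _ ↦ (1 : ℝ)) ω) P :=
    ((integrable_const _).indicator (h.measurableSet_ne i)).const_mul _
  calc |β| = ‖∫ ω, Y i ω ∂P‖ := by rw [h.mean, Real.norm_eq_abs]
    _ ≤ ∫ ω, B * {ω | Y i ω ≠ 0}.indicator (fun _ ↦ (1 : ℝ)) ω ∂P := by
        refine norm_integral_le_of_norm_le hi (ae_of_all _ fun ω ↦ ?_)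
        by_cases h0 : Y i ω = 0
        · simp [h0]
        · simpa [h0] using h.bound i ω
    _ = B * F := by
        rw [integral_const_mul, integral_indicator_const _ (h.measurableSet_ne i), h.prob]
        simp

lemma bound_nonneg (h : IsBoundedSample P Y B β v F) (hn : 0 < n) : 0 ≤ B := by
  obtain ⟨ω⟩ : Nonempty Ω := nonempty_of_isProbabilityMeasure P
  exact (abs_nonneg _).trans (h.bound ⟨0, hn⟩ ω)

lemma abs_le (h : IsBoundedSample P Y B β v F) (hn : 0 < n) : |β| ≤ B := by
  refine (h.abs_le_mul hn).trans (mul_le_of_le_one_right (h.bound_nonneg hn) ?_)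
  rw [← h.prob ⟨0, hn⟩]
  exact measureReal_le_one

lemma integral_sq (h : IsBoundedSample P Y B β v F) (i : Fin n) :
    ∫ ω, Y i ω ^ 2 ∂P = v + β ^ 2 := by
  have h1 := integral_quadratic (P := P) (h.meas i).aemeasurable (h.bound i) (β ^ 2) (-2 * β) 1
  rw [h.mean] at h1
  have h2 : ∫ ω, (β ^ 2 + -2 * β * Y i ω + 1 * Y i ω ^ 2) ∂P = v := by
    rw [← h.var i]
    congr 1
    ext ω
    ring
  linarith

/-- The Cauchy-Schwarz inequality on the event that the variable is nonzero. -/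
lemma sq_mean_le (h : IsBoundedSample P Y B β v F) (hn : 0 < n) : β ^ 2 ≤ (v + β ^ 2) * F := by
  let i : Fin n := ⟨0, hn⟩
  have hF := h.prob_nonneg hn
  rcases hF.eq_or_lt with hF | hF
  · have := h.abs_le_mul hn
    rw [← hF, mul_zero] at this
    have h0 : β = 0 := abs_nonpos_iff.1 this
    simp [h0, ← hF]
  · have hpt : ∀ ω, (β * {ω | Y i ω ≠ 0}.indicator (fun _ ↦ (1 : ℝ)) ω - F * Y i ω) ^ 2
        = β ^ 2 * {ω | Y i ω ≠ 0}.indicator (fun _ ↦ (1 : ℝ)) ω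
          + (0 + (-2 * β * F) * Y i ω + F ^ 2 * Y i ω ^ 2) := by
      intro ω
      by_cases h0 : Y i ω = 0
      · simp [h0]
      · simp [h0]; ring
    have h1 : 0 ≤ ∫ ω, (β * {ω | Y i ω ≠ 0}.indicator (fun _ ↦ (1 : ℝ)) ω - F * Y i ω) ^ 2 ∂P :=
      integral_nonneg fun ω ↦ sq_nonneg _
    simp_rw [hpt] at h1
    have hb : ∀ ω, |0 + (-2 * β * F) * Y i ω + F ^ 2 * Y i ω ^ 2|
        ≤ |2 * β * F| * B + F ^ 2 * B ^ 2 := by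
      intro ω
      have hY := h.bound i ω
      have hY2 : Y i ω ^ 2 ≤ B ^ 2 := by
        rw [← sq_abs]; exact pow_le_pow_left₀ (abs_nonneg _) hY 2
      rw [zero_add]
      refine (abs_add_le _ _).trans (add_le_add ?_ ?_)
      · rw [abs_mul, neg_mul, neg_mul, abs_neg]; gcongr
      · rw [abs_of_nonneg (by positivity)]; gcongr
    have hm := h.meas i
    rw [integral_add (((integrable_const _).indicator (h.measurableSet_ne i)).const_mul _)
      (integrable_of_abs_le (by fun_prop) hb), integral_const_mul,
      integral_indicator_const _ (h.measurableSet_ne i), h.prob,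
      integral_quadratic hm.aemeasurable (h.bound i), h.mean, h.integral_sq] at h1
    simp only [smul_eq_mul, mul_one] at h1
    have h2 : 0 ≤ F * ((v + β ^ 2) * F - β ^ 2) := by nlinarith
    have := nonneg_of_mul_nonneg_right h2 hF
    linarith

lemma second_moment_le (h : IsBoundedSample P Y B β v F) (hn : 0 < n) :
    v + β ^ 2 ≤ B ^ 2 * F := by
  let i : Fin n := ⟨0, hn⟩
  rw [← h.integral_sq i]
  calc ∫ ω, Y i ω ^ 2 ∂P
      ≤ ∫ ω, B ^ 2 * {ω | Y i ω ≠ 0}.indicator (fun _ ↦ (1 : ℝ)) ω ∂P := by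
        refine integral_mono_of_nonneg (ae_of_all _ fun ω ↦ sq_nonneg _)
          (((integrable_const _).indicator (h.measurableSet_ne i)).const_mul _)
          (ae_of_all _ fun ω ↦ ?_)
        by_cases h0 : Y i ω = 0
        · simp [h0]
        · simpa [h0] using sq_le_sq' (_root_.abs_le.1 (h.bound i ω)).1
            (_root_.abs_le.1 (h.bound i ω)).2
    _ = B ^ 2 * F := by
        rw [integral_const_mul, integral_indicator_const _ (h.measurableSet_ne i), h.prob]
        simp

lemma sampleMean_sub (hn : 0 < n) (y : Fin n → ℝ) (b : ℝ) :
    sampleMean y - b = (1 / (n : ℝ)) * ∑ i, (y i - b) := by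
  have hn' : (n : ℝ) ≠ 0 := by positivity
  rw [sampleMean, Finset.sum_sub_distrib]
  simp
  field_simp

/-- Bernstein's inequality for the sample mean. -/
lemma measureReal_lt_abs_le (h : IsBoundedSample P Y B β v F) (hn : 0 < n) (hB : 0 < B) {u : ℝ}
    (hu : 0 < u) :
    P.real {ω | √(2 * u * v / n) + 2 * B * u / (3 * n) < |sampleMean (fun i ↦ Y i ω) - β|}
      ≤ 2 * Real.exp (-u) := by
  simp_rw [sampleMean_sub hn]
  refine bernstein_abs (D := fun i ω ↦ Y i ω - β) (b := 2 * B)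
    (h.indep.comp (fun _ x ↦ x - β) fun _ ↦ measurable_id.sub_const _)
    (fun i ↦ ((h.meas i).sub_const _).aemeasurable) (by positivity) (fun i ω ↦ ?_)
    (fun i ↦ ?_) h.var hn hu
  · refine (abs_sub _ _).trans ?_
    linarith [h.bound i ω, h.abs_le hn]
  · rw [integral_sub (integrable_of_abs_le (h.meas i).aemeasurable (h.bound i))
      (integrable_const _), h.mean]
    simp

lemma abs_sub_le (h : IsBoundedSample P Y B β v F) (hn : 0 < n) (i : Fin n) (ω : Ω) :
    |Y i ω - β| ≤ 2 * B := by
  refine (abs_sub _ _).trans ?_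
  linarith [h.bound i ω, h.abs_le hn]

lemma sub_sq_le (h : IsBoundedSample P Y B β v F) (hn : 0 < n) (i : Fin n) (ω : Ω) :
    (Y i ω - β) ^ 2 ≤ 4 * B ^ 2 := by
  rw [← sq_abs]
  exact (pow_le_pow_left₀ (abs_nonneg _) (h.abs_sub_le hn i ω) 2).trans (le_of_eq (by ring))

/-- The empirical second moment about the mean is rarely much smaller than the variance. -/
lemma measureReal_secondMoment_lt_le (h : IsBoundedSample P Y B β v F) (hn : 0 < n) (hB : 0 < B)
    {u : ℝ} (hu : 0 < u) :
    P.real {ω | (1 / (n : ℝ)) * ∑ i, (Y i ω - β) ^ 2 < v - √(2 * u * (4 * B ^ 2 * v) / n)}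
      ≤ Real.exp (-u) := by
  rcases (h.variance_nonneg hn).eq_or_lt with hv | hv
  · have : {ω | (1 / (n : ℝ)) * ∑ i, (Y i ω - β) ^ 2 < v - √(2 * u * (4 * B ^ 2 * v) / n)} = ∅ := by
      refine Set.eq_empty_of_forall_notMem fun ω hω ↦ ?_
      rw [← hv] at hω
      simp only [Set.mem_ofPred_eq, mul_zero, zero_div, Real.sqrt_zero, sub_zero] at hω
      exact hω.not_ge (mul_nonneg (by positivity) (Finset.sum_nonneg fun i _ ↦ sq_nonneg _))
    rw [this, measureReal_empty]
    positivity
  · refine lower_tail_of_nonneg (V := fun i ω ↦ (Y i ω - β) ^ 2)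
      (h.indep.comp (fun _ x ↦ (x - β) ^ 2) fun _ ↦ by fun_prop)
      (fun i ↦ (((h.meas i).sub_const _).pow_const 2).aemeasurable)
      (fun i ω ↦ sq_nonneg _) (fun i ω ↦ h.sub_sq_le hn i ω) h.var (by positivity)
      (fun i ↦ ?_) hn hu
    rw [← h.var i, ← integral_const_mul]
    have hm := h.meas i
    refine integral_mono_of_nonneg (ae_of_all _ fun ω ↦ sq_nonneg _)
      ((integrable_of_abs_le (C := 4 * B ^ 2) (by fun_prop) fun ω ↦ ?_).const_mul _)
      (ae_of_all _ fun ω ↦ ?_)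
    · rw [abs_of_nonneg (sq_nonneg _)]
      exact h.sub_sq_le hn i ω
    · simp only
      rw [sq ((Y i ω - β) ^ 2)]
      exact mul_le_mul_of_nonneg_right (h.sub_sq_le hn i ω) (sq_nonneg _)

/-- The data-driven threshold, up to a factor `κ < 1`, rarely fails to dominate the error of the
sample mean: either the variance was underestimated or Bernstein's inequality was violated. -/
lemma measureReal_threshold_lt_le (h : IsBoundedSample P Y B β v F) (hn : 3 ≤ n) (hB : 0 < B)
    {γ κ ε : ℝ} (hγ : 0 < γ) (hκ : 0 < κ) (hκ1 : κ < 1) (hε : 0 ≤ ε) (hε1 : 2 * ε < 1)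
    (hl : γ * (Real.log n / n) ≤ ε ^ 2 / 16) :
    P.real {ω | κ * threshold γ B (fun i ↦ Y i ω) < |sampleMean (fun i ↦ Y i ω) - β|}
      ≤ 5 * Real.exp (-(κ ^ 2 * (1 - 2 * ε) * γ * Real.log n)) := by
  have hn0 : 0 < n := by lia
  have hlog : 0 < Real.log n := Real.log_pos (by exact_mod_cast (by lia : 1 < n))
  have hv := h.variance_nonneg hn0
  have l0 : 0 ≤ Real.log n / n := by positivity
  set ρ := κ ^ 2 * (1 - 2 * ε) with hρ
  have hκ2 : κ ^ 2 ≤ 1 := by nlinarith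
  have ρ0 : 0 < ρ := mul_pos (by positivity) (by linarith)
  have ρ1 : ρ ≤ 1 := by nlinarith [sq_nonneg κ]
  have ρκ : ρ ≤ κ := by nlinarith [sq_nonneg κ]
  have hu : 0 < γ * Real.log n := by positivity
  have hu' : 0 < ρ * γ * Real.log n := by positivity
  have h1 := h.measureReal_secondMoment_lt_le hn0 hB hu
  have h2 := h.measureReal_lt_abs_le hn0 hB hu
  have h3 := h.measureReal_lt_abs_le hn0 hB hu'
  have hexp : Real.exp (-(γ * Real.log n)) ≤ Real.exp (-(ρ * γ * Real.log n)) := by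
    rw [Real.exp_le_exp]; nlinarith
  set A₁ := {ω | (1 / (n : ℝ)) * ∑ i, (Y i ω - β) ^ 2
    < v - √(2 * (γ * Real.log n) * (4 * B ^ 2 * v) / n)}
  set A₂ := {ω | √(2 * (γ * Real.log n) * v / n) + 2 * B * (γ * Real.log n) / (3 * n)
    < |sampleMean (fun i ↦ Y i ω) - β|}
  set A₃ := {ω | √(2 * (ρ * γ * Real.log n) * v / n) + 2 * B * (ρ * γ * Real.log n) / (3 * n)
    < |sampleMean (fun i ↦ Y i ω) - β|}
  have hsub : {ω | κ * threshold γ B (fun i ↦ Y i ω) < |sampleMean (fun i ↦ Y i ω) - β|}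
      ⊆ (A₁ ∪ A₂) ∪ A₃ := by
    intro ω hω
    by_contra hcon
    simp only [Set.mem_union, not_or, A₁, A₂, A₃, Set.mem_ofPred_eq, not_lt] at hcon
    obtain ⟨⟨c1, c2⟩, c3⟩ := hcon
    rw [Set.mem_ofPred_eq] at hω
    refine hω.not_ge (c3.trans ?_)
    have hV : (1 - 2 * ε) * v ≤ varBound γ B (fun i ↦ Y i ω) := by
      refine le_varBound (b := β) (by lia) _ hγ.le hB.le hv hε (by linarith) hl ?_ ?_
      · refine (le_of_eq ?_).trans c1
        congr 2
        ring
      · refine c2.trans (le_of_eq ?_)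
        congr 1
        · ring_nf
        · field_simp
    rw [threshold, mul_add]
    refine add_le_add ?_ ?_
    · rw [← sqrt_sq_mul hκ.le]
      refine Real.sqrt_le_sqrt ?_
      calc 2 * (ρ * γ * Real.log n) * v / n
          = κ ^ 2 * (2 * γ * ((1 - 2 * ε) * v) * (Real.log n / n)) := by rw [hρ]; ring
        _ ≤ _ := by gcongr
    · calc 2 * B * (ρ * γ * Real.log n) / (3 * n)
          = ρ * (2 * B * γ * Real.log n / (3 * n)) := by ring
        _ ≤ _ := by gcongr
  refine (measureReal_mono hsub).trans ((measureReal_union_le _ _).trans ?_)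
  have := measureReal_union_le (μ := P) A₁ A₂
  linarith

lemma abs_sampleMean_sub_le (h : IsBoundedSample P Y B β v F) (hn : 0 < n) (ω : Ω) :
    |sampleMean (fun i ↦ Y i ω) - β| ≤ 2 * B := by
  have hn' : (0 : ℝ) < n := by exact_mod_cast hn
  rw [sampleMean_sub hn, abs_mul, abs_of_pos (by positivity), one_div, ← div_eq_inv_mul,
    div_le_iff₀ hn', mul_comm]
  exact abs_sum_le_of_abs_le fun i ↦ h.abs_sub_le hn i ω

lemma integrable_thresholdedMean_sub_sq (h : IsBoundedSample P Y B β v F) (hn : 0 < n) (γ : ℝ) :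
    Integrable (fun ω ↦ (thresholdedMean γ B (fun i ↦ Y i ω) - β) ^ 2) P := by
  have hH : Measurable fun ω ↦ thresholdedMean γ B (fun i ↦ Y i ω) :=
    (measurable_thresholdedMean γ B).comp h.measurable_pi
  refine integrable_of_abs_le (C := (2 * B) ^ 2)
    ((hH.sub_const β).pow_const 2).aemeasurable fun ω ↦ ?_
  rw [abs_pow]
  refine pow_le_pow_left₀ (abs_nonneg _) ?_ 2
  rw [thresholdedMean]
  split_ifs
  · exact h.abs_sampleMean_sub_le hn ω
  · rw [zero_sub, abs_neg]
    linarith [h.abs_le hn, h.bound_nonneg hn]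

/-- Risk bound for coefficients whose probability of being nonzero is not too small. Off the bad
event the oracle bound holds; on it, the squared error is at most the square of a Bernstein
deviation at the level `K log n`, outside an event of still smaller probability. -/
lemma integral_thresholdedMean_sub_sq_le (h : IsBoundedSample P Y B β v F) (hn : 3 ≤ n)
    (hB : 0 < B) {γ κ ε K : ℝ} (hγ : 0 < γ) (hκ : 0 < κ) (hκ1 : κ < 1) (hε : 0 ≤ ε)
    (hε1 : 2 * ε < 1) (hK : 0 < K) (hl : γ * (Real.log n / n) ≤ ε ^ 2 / 16) :
    ∫ ω, (thresholdedMean γ B (fun i ↦ Y i ω) - β) ^ 2 ∂P ≤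
      4 / (1 - κ) ^ 2 * min (β ^ 2)
        (16 * γ * (Real.log n / n) * v + 41 * γ ^ 2 * B ^ 2 * (Real.log n / n) ^ 2)
      + (β ^ 2 + 4 * K * v * (Real.log n / n) + K ^ 2 * B ^ 2 * (Real.log n / n) ^ 2) *
        (5 * Real.exp (-(κ ^ 2 * (1 - 2 * ε) * γ * Real.log n)))
      + 4 * B ^ 2 * (2 * Real.exp (-(K * Real.log n))) := by
  have hn0 : 0 < n := by lia
  have hn' : (0 : ℝ) < n := by exact_mod_cast hn0
  have hlog : 0 < Real.log n := Real.log_pos (by exact_mod_cast (by lia : 1 < n))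
  have hv := h.variance_nonneg hn0
  have hbad := h.measureReal_threshold_lt_le hn hB hγ hκ hκ1 hε hε1 hl
  have hfar := h.measureReal_lt_abs_le hn0 hB (mul_pos hK hlog)
  have l0 : 0 ≤ Real.log n / n := by positivity
  set l := Real.log n / n with hldef
  have hm := h.measurable_pi
  have hZ : Measurable fun ω ↦ sampleMean (fun i ↦ Y i ω) := measurable_sampleMean.comp hm
  have hT : Measurable fun ω ↦ threshold γ B (fun i ↦ Y i ω) := (measurable_threshold γ B).comp hm
  set bad := {ω | κ * threshold γ B (fun i ↦ Y i ω) < |sampleMean (fun i ↦ Y i ω) - β|} with hbd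
  set far := {ω | √(2 * (K * Real.log n) * v / n) + 2 * B * (K * Real.log n) / (3 * n)
    < |sampleMean (fun i ↦ Y i ω) - β|} with hfr
  have mbad : MeasurableSet bad := measurableSet_lt (hT.const_mul κ) (hZ.sub_const β).abs
  have mfar : MeasurableSet far := measurableSet_lt measurable_const (hZ.sub_const β).abs
  set L := 4 * K * v * l + K ^ 2 * B ^ 2 * l ^ 2 with hL
  have L0 : 0 ≤ L := by positivity
  have hdev : ∀ ω, ω ∉ far → (sampleMean (fun i ↦ Y i ω) - β) ^ 2 ≤ L := by
    intro ω hω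
    rw [hfr, Set.mem_ofPred_eq, not_lt] at hω
    have := pow_le_pow_left₀ (abs_nonneg _) hω 2
    rw [sq_abs] at this
    refine this.trans ((add_sq_le_two_mul _ _).trans ?_)
    rw [Real.sq_sqrt (by positivity), hL,
      show 2 * (K * Real.log n) * v / n = 2 * K * v * l by rw [hldef]; ring,
      show 2 * B * (K * Real.log n) / (3 * n) = 2 / 3 * K * B * l by rw [hldef]; field_simp]
    have : 0 ≤ K ^ 2 * B ^ 2 * l ^ 2 := by positivity
    nlinarith
  let T : Ω → ℝ := fun ω ↦
    16 * γ * l * ((1 / (n : ℝ)) * ∑ i, (Y i ω - β) ^ 2) + 41 * γ ^ 2 * B ^ 2 * l ^ 2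
  have iY : ∀ i, Integrable (fun ω ↦ (Y i ω - β) ^ 2) P := fun i ↦ by
    have := h.meas i
    refine integrable_of_abs_le (C := 4 * B ^ 2) (by fun_prop) fun ω ↦ ?_
    rw [abs_of_nonneg (sq_nonneg _)]
    exact h.sub_sq_le hn0 i ω
  have iS : Integrable (fun ω ↦ ∑ i, (Y i ω - β) ^ 2) P := integrable_finsetSum _ fun i _ ↦ iY i
  have iT : Integrable T P := ((iS.const_mul _).const_mul _).add (integrable_const _)
  have eT : ∫ ω, T ω ∂P = 16 * γ * l * v + 41 * γ ^ 2 * B ^ 2 * l ^ 2 := by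
    simp only [T]
    rw [integral_add ((iS.const_mul _).const_mul _) (integrable_const _), integral_const_mul,
      integral_const_mul, integral_finsetSum _ fun i _ ↦ iY i]
    simp only [h.var, Finset.sum_const, Finset.card_univ, Fintype.card_fin, nsmul_eq_mul,
      integral_const, probReal_univ, smul_eq_mul, one_mul]
    field_simp
  have T0 : ∀ ω, 0 ≤ T ω := fun ω ↦ by
    have : 0 ≤ ∑ i, (Y i ω - β) ^ 2 := Finset.sum_nonneg fun i _ ↦ sq_nonneg _
    positivity
  have iM : Integrable (fun ω ↦ min (β ^ 2) (T ω)) P := (integrable_const _).inf iT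
  have eM : ∫ ω, min (β ^ 2) (T ω) ∂P ≤ min (β ^ 2) (∫ ω, T ω ∂P) := by
    refine le_min ?_ (integral_mono iM iT fun ω ↦ min_le_right _ _)
    refine (integral_mono iM (integrable_const _) fun ω ↦ min_le_left _ _).trans ?_
    simp
  have hpt : ∀ ω, (thresholdedMean γ B (fun i ↦ Y i ω) - β) ^ 2 ≤
      4 / (1 - κ) ^ 2 * min (β ^ 2) (T ω) + (β ^ 2 + L) * bad.indicator (fun _ ↦ (1 : ℝ)) ω
        + 4 * B ^ 2 * far.indicator (fun _ ↦ (1 : ℝ)) ω := by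
    intro ω
    have hη := threshold_nonneg (fun i ↦ Y i ω) hγ.le hB.le
    have hM : 0 ≤ min (β ^ 2) (T ω) := le_min (sq_nonneg _) (T0 ω)
    have hM' : 0 ≤ 4 / (1 - κ) ^ 2 * min (β ^ 2) (T ω) := by positivity
    by_cases hb : ω ∈ bad
    · rw [Set.indicator_of_mem hb]
      have h1 : (thresholdedMean γ B (fun i ↦ Y i ω) - β) ^ 2 ≤
          β ^ 2 + (sampleMean (fun i ↦ Y i ω) - β) ^ 2 := by
        rw [thresholdedMean]
        split_ifs
        · nlinarith [sq_nonneg β]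
        · nlinarith [sq_nonneg (sampleMean (fun i ↦ Y i ω) - β)]
      by_cases hf : ω ∈ far
      · rw [Set.indicator_of_mem hf]
        have h2 := pow_le_pow_left₀ (abs_nonneg _) (h.abs_sampleMean_sub_le hn0 ω) 2
        rw [sq_abs] at h2
        nlinarith
      · rw [Set.indicator_of_notMem hf]
        linarith [hdev ω hf]
    · rw [Set.indicator_of_notMem hb]
      have hb' : |sampleMean (fun i ↦ Y i ω) - β| ≤ κ * threshold γ B (fun i ↦ Y i ω) := by
        rwa [hbd, Set.mem_ofPred_eq, not_lt] at hb
      have h1 := hardThreshold_sub_sq_le hη hκ.le hκ1 hb'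
      have h2 := threshold_sq_le (by lia) (fun i ↦ Y i ω) β hγ.le hB.le
      have h3 : 0 ≤ 4 * B ^ 2 * far.indicator (fun _ ↦ (1 : ℝ)) ω :=
        mul_nonneg (by positivity) (Set.indicator_nonneg (fun _ _ ↦ zero_le_one) _)
      have h4 : 4 / (1 - κ) ^ 2 * min (β ^ 2) (threshold γ B (fun i ↦ Y i ω) ^ 2)
          ≤ 4 / (1 - κ) ^ 2 * min (β ^ 2) (T ω) := by
        gcongr
      rw [thresholdedMean]
      linarith
  have i1 := iM.const_mul (4 / (1 - κ) ^ 2)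
  have i2 : Integrable (fun ω ↦ (β ^ 2 + L) * bad.indicator (fun _ ↦ (1 : ℝ)) ω) P :=
    ((integrable_const _).indicator mbad).const_mul _
  have i3 : Integrable (fun ω ↦ 4 * B ^ 2 * far.indicator (fun _ ↦ (1 : ℝ)) ω) P :=
    ((integrable_const _).indicator mfar).const_mul _
  have i12 : Integrable (fun ω ↦ 4 / (1 - κ) ^ 2 * min (β ^ 2) (T ω)
    + (β ^ 2 + L) * bad.indicator (fun _ ↦ (1 : ℝ)) ω) P := i1.add i2
  refine (integral_mono_of_nonneg (ae_of_all _ fun ω ↦ sq_nonneg _) (i12.add i3)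
    (ae_of_all _ hpt)).trans ?_
  rw [integral_add' i12 i3, integral_add i1 i2, integral_const_mul, integral_const_mul,
    integral_const_mul, integral_indicator_const _ mbad, integral_indicator_const _ mfar]
  simp only [smul_eq_mul, mul_one]
  rw [← eT, add_assoc (β ^ 2), ← hL]
  gcongr

/-- The exponential moment of the number of nonzero variables. -/
lemma integral_exp_count_le (h : IsBoundedSample P Y B β v F) :
    ∫ ω, Real.exp (2 * ∑ i, {ω | Y i ω ≠ 0}.indicator (fun _ ↦ (1 : ℝ)) ω) ∂P
      ≤ Real.exp (7 * (n * F)) := by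
  have e2 : Real.exp 2 ≤ 8 := by
    rw [show (2 : ℝ) = 1 + 1 by norm_num, Real.exp_add]
    nlinarith [Real.exp_one_lt_d9, Real.exp_pos 1]
  let N : Fin n → Ω → ℝ := fun i ↦ {ω | Y i ω ≠ 0}.indicator (fun _ ↦ (1 : ℝ))
  have hNm : ∀ i, Measurable (N i) := fun i ↦ measurable_const.indicator (h.measurableSet_ne i)
  have hN : iIndepFun N P :=
    h.indep.comp (fun _ ↦ ({0}ᶜ : Set ℝ).indicator fun _ ↦ (1 : ℝ)) fun _ ↦
      measurable_const.indicator (measurableSet_singleton 0).compl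
  have h1 := hN.mgf_sum (t := 2) hNm Finset.univ
  have h2 : ∀ i, mgf (N i) P 2 ≤ Real.exp (7 * F) := by
    intro i
    have : ∀ ω, Real.exp (2 * N i ω) = 1 + (Real.exp 2 - 1) * N i ω := by
      intro ω
      by_cases h0 : Y i ω = 0
      · simp [N, h0]
      · simp [N, h0]
    rw [mgf]
    simp_rw [this]
    rw [integral_add (integrable_const _)
      (((integrable_const _).indicator (h.measurableSet_ne i)).const_mul _), integral_const_mul,
      integral_indicator_const _ (h.measurableSet_ne i), h.prob]
    have hF : 0 ≤ F := by rw [← h.prob i]; exact measureReal_nonneg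
    have := Real.add_one_le_exp (7 * F)
    simp only [integral_const, probReal_univ, smul_eq_mul, mul_one]
    nlinarith
  calc ∫ ω, Real.exp (2 * ∑ i, N i ω) ∂P = mgf (∑ i, N i) P 2 := by simp [mgf]
    _ = ∏ i, mgf (N i) P 2 := h1
    _ ≤ ∏ _i : Fin n, Real.exp (7 * F) :=
        Finset.prod_le_prod (fun _ _ ↦ mgf_nonneg) fun i _ ↦ h2 i
    _ = Real.exp (7 * (n * F)) := by
        rw [Finset.prod_const, Finset.card_univ, Fintype.card_fin, ← Real.exp_nat_mul]
        ring_nf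

/-- Risk bound for coefficients that are rarely observed. The threshold exceeds
`4 γ B log n / n`, so the estimate vanishes unless at least `4 γ log n` observations are
nonzero, which is very unlikely. -/
lemma integral_thresholdedMean_sub_sq_le_of_rare (h : IsBoundedSample P Y B β v F) (hn : 3 ≤ n)
    (hB : 0 < B) {γ : ℝ} (hγ : 0 < γ) (hF : n * F ≤ γ / 8 * Real.log n) :
    ∫ ω, (thresholdedMean γ B (fun i ↦ Y i ω) - β) ^ 2 ∂P ≤
      β ^ 2 + 112 * (B ^ 2 * F / n) * Real.exp (-(3 * γ * Real.log n)) := by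
  have hn0 : 0 < n := by lia
  have hn' : (0 : ℝ) < n := by exact_mod_cast hn0
  have hlog : 0 < Real.log n := Real.log_pos (by exact_mod_cast (by lia : 1 < n))
  have F0 := h.prob_nonneg hn0
  set m := 4 * γ * Real.log n with hm
  have m0 : 0 < m := by positivity
  let N : Ω → ℝ := fun ω ↦ ∑ i, {ω | Y i ω ≠ 0}.indicator (fun _ ↦ (1 : ℝ)) ω
  have N0 : ∀ ω, 0 ≤ N ω := fun ω ↦
    Finset.sum_nonneg fun i _ ↦ Set.indicator_nonneg (fun _ _ ↦ zero_le_one) _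
  have hmean : ∀ ω, |sampleMean (fun i ↦ Y i ω)| ≤ B * N ω / n := by
    intro ω
    rw [sampleMean, abs_mul, abs_of_pos (by positivity), one_div, ← div_eq_inv_mul]
    gcongr
    rw [Finset.mul_sum]
    refine (Finset.abs_sum_le_sum_abs _ _).trans (Finset.sum_le_sum fun i _ ↦ ?_)
    by_cases h0 : Y i ω = 0
    · simp [h0]
    · simpa [h0] using h.bound i ω
  have hpt : ∀ ω, (thresholdedMean γ B (fun i ↦ Y i ω) - β) ^ 2 ≤ β ^ 2
      + 16 * B ^ 2 / n ^ 2 * Real.exp (-m) * (Real.exp (2 * N ω) - 1) := by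
    intro ω
    have hexp0 : 0 ≤ Real.exp (2 * N ω) - 1 := by
      linarith [Real.one_le_exp (by linarith [N0 ω] : 0 ≤ 2 * N ω)]
    have hpos : 0 ≤ 16 * B ^ 2 / n ^ 2 * Real.exp (-m) * (Real.exp (2 * N ω) - 1) := by positivity
    rw [thresholdedMean]
    split_ifs with hc
    · have h1 : 4 * γ * B * (Real.log n / n) ≤ threshold γ B (fun i ↦ Y i ω) := by
        have hV : 8 * γ * B ^ 2 * (Real.log n / n) ≤ varBound γ B (fun i ↦ Y i ω) := by
          have := sampleVar_nonneg (fun i ↦ Y i ω)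
          have h3 : 0 ≤ 2 * B * √(2 * γ * sampleVar (fun i ↦ Y i ω) * (Real.log n / n)) := by
            positivity
          rw [varBound]
          linarith
        have h4 : 4 * γ * B * (Real.log n / n)
            ≤ √(2 * γ * varBound γ B (fun i ↦ Y i ω) * (Real.log n / n)) := by
          refine Real.le_sqrt_of_sq_le ?_
          calc (4 * γ * B * (Real.log n / n)) ^ 2
              = 2 * γ * (8 * γ * B ^ 2 * (Real.log n / n)) * (Real.log n / n) := by ring
            _ ≤ _ := by gcongr
        have h5 : 0 ≤ 2 * B * γ * Real.log n / (3 * n) := by positivity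
        rw [threshold]
        linarith
      have hmN : m ≤ N ω := by
        have h2 := h1.trans (hc.trans (hmean ω))
        rw [show 4 * γ * B * (Real.log n / n) = B * m / n by rw [hm]; ring,
          div_le_div_iff_of_pos_right hn'] at h2
        exact le_of_mul_le_mul_left h2 hB
      -- `N` is a positive integer here
      have hN1 : 1 ≤ N ω := by
        by_contra! hlt
        have hz : ∀ i, {ω | Y i ω ≠ 0}.indicator (fun _ ↦ (1 : ℝ)) ω = 0 := by
          intro i
          by_contra hne
          have hmem : ω ∈ {ω | Y i ω ≠ 0} := Set.mem_of_indicator_ne_zero hne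
          have : (1 : ℝ) ≤ N ω := by
            have := Finset.single_le_sum (f := fun i ↦
              {ω | Y i ω ≠ 0}.indicator (fun _ ↦ (1 : ℝ)) ω)
              (fun i _ ↦ Set.indicator_nonneg (fun _ _ ↦ zero_le_one) ω) (Finset.mem_univ i)
            simpa only [Set.indicator_of_mem hmem] using this
          linarith
        have : N ω = 0 := Finset.sum_eq_zero fun i _ ↦ hz i
        linarith
      have hβ : |β| ≤ B * N ω / n := by
        refine (h.abs_le_mul hn0).trans ?_
        rw [le_div_iff₀ hn', mul_assoc]
        refine mul_le_mul_of_nonneg_left ?_ hB.le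
        refine le_trans ?_ hmN
        rw [hm]
        nlinarith [mul_pos hγ hlog]
      have h2 : |sampleMean (fun i ↦ Y i ω) - β| ≤ 2 * B * N ω / n := by
        refine (abs_sub _ _).trans ((add_le_add (hmean ω) hβ).trans (le_of_eq (by ring)))
      have h3 : (sampleMean (fun i ↦ Y i ω) - β) ^ 2 ≤ 4 * B ^ 2 / n ^ 2 * N ω ^ 2 := by
        rw [← sq_abs]
        exact (pow_le_pow_left₀ (abs_nonneg _) h2 2).trans (le_of_eq (by ring))
      have h4 : N ω ^ 2 ≤ 4 * Real.exp (-m) * (Real.exp (2 * N ω) - 1) := by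
        have q1 := Real.quadratic_le_exp_of_nonneg (N0 ω)
        have q2 : 1 ≤ Real.exp (N ω - m) := Real.one_le_exp (by linarith)
        have q3 : Real.exp (N ω) * Real.exp (N ω - m) = Real.exp (-m) * Real.exp (2 * N ω) := by
          rw [← Real.exp_add, ← Real.exp_add]; ring_nf
        have q4 : 2 ≤ Real.exp (2 * N ω) := by linarith [Real.add_one_le_exp (2 * N ω)]
        have q5 : Real.exp (N ω) ≤ Real.exp (N ω) * Real.exp (N ω - m) :=
          le_mul_of_one_le_right (Real.exp_pos _).le q2
        have q6 := mul_le_mul_of_nonneg_left q4 (Real.exp_pos (-m)).le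
        nlinarith [N0 ω]
      have h5 : 4 * B ^ 2 / n ^ 2 * N ω ^ 2
          ≤ 4 * B ^ 2 / n ^ 2 * (4 * Real.exp (-m) * (Real.exp (2 * N ω) - 1)) := by gcongr
      have h6 : 4 * B ^ 2 / n ^ 2 * (4 * Real.exp (-m) * (Real.exp (2 * N ω) - 1))
          = 16 * B ^ 2 / n ^ 2 * Real.exp (-m) * (Real.exp (2 * N ω) - 1) := by ring
      linarith [sq_nonneg β]
    · rw [zero_sub, neg_sq]
      linarith
  have hNm : Measurable N :=
    Finset.measurable_sum _ fun i _ ↦ measurable_const.indicator (h.measurableSet_ne i)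
  have iN : Integrable (fun ω ↦ Real.exp (2 * N ω)) P := by
    refine integrable_exp_of_abs_le (C := n * 1) _ hNm.aemeasurable fun ω ↦ ?_
    refine abs_sum_le_of_abs_le fun i ↦ ?_
    by_cases h0 : Y i ω = 0 <;> simp [h0]
  have hint : ∫ ω, Real.exp (2 * N ω) ∂P ≤ Real.exp (7 * (n * F)) := h.integral_exp_count_le
  have i1 : Integrable (fun ω ↦ 16 * B ^ 2 / n ^ 2 * Real.exp (-m) * (Real.exp (2 * N ω) - 1)) P :=
    (iN.sub (integrable_const _)).const_mul _
  refine (integral_mono_of_nonneg (ae_of_all _ fun ω ↦ sq_nonneg _)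
    ((integrable_const _).add i1) (ae_of_all _ hpt)).trans ?_
  rw [integral_add' (integrable_const _) i1, integral_const_mul,
    integral_sub iN (integrable_const _)]
  simp only [integral_const, probReal_univ, smul_eq_mul, one_mul, mul_one]
  -- `exp x - 1 ≤ x exp x`
  have hx : Real.exp (7 * (n * F)) - 1 ≤ 7 * (n * F) * Real.exp (7 * (n * F)) := by
    have := Real.add_one_le_exp (-(7 * (n * F)))
    have h2 := mul_le_mul_of_nonneg_right this (Real.exp_pos (7 * (n * F))).le
    rw [← Real.exp_add] at h2
    simp only [neg_add_cancel, Real.exp_zero] at h2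
    linarith
  have hee : Real.exp (-m) * Real.exp (7 * (n * F)) ≤ Real.exp (-(3 * γ * Real.log n)) := by
    rw [← Real.exp_add, Real.exp_le_exp, hm]
    nlinarith [mul_pos hγ hlog]
  refine add_le_add le_rfl ?_
  calc 16 * B ^ 2 / n ^ 2 * Real.exp (-m) * (∫ ω, Real.exp (2 * N ω) ∂P - 1)
      ≤ 16 * B ^ 2 / n ^ 2 * Real.exp (-m) * (7 * (n * F) * Real.exp (7 * (n * F))) := by
        refine mul_le_mul_of_nonneg_left ?_ (by positivity)
        linarith
    _ = 112 * (B ^ 2 * F / n) * (Real.exp (-m) * Real.exp (7 * (n * F))) := by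
        field_simp; ring
    _ ≤ _ := by gcongr

end IsBoundedSample

end Risk

lemma tendsto_log_div_natCast : Tendsto (fun n : ℕ ↦ Real.log n / n) atTop (𝓝 0) :=
  (Real.isLittleO_log_id_atTop.tendsto_div_nhds_zero).comp tendsto_natCast_atTop_atTop

lemma min_le_mul_min {x y z A : ℝ} (hx : 0 ≤ x) (hA : 1 ≤ A) (h : z ≤ A * y) :
    min x z ≤ A * min x y := by
  rw [mul_min_of_nonneg _ _ (by linarith)]
  exact min_le_min (by nlinarith) h

set_option maxHeartbeats 400000 in
/-- The risk bound for one coefficient, with constants that depend only on `γ`, `c` and on a lower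
bound `c₀` for the ratio of the second moment to its largest possible value `B ^ 2 * F`. The
exponent `a` still exceeds `c` because the fraction `κ` of the threshold that has to dominate the
error, and the precision `ε` of the variance estimate, can be chosen close to `1` and `0`. -/
theorem exists_integral_thresholdedMean_sub_sq_le {γ c c₀ : ℝ} (hc : 0 < c) (hγ : c < γ)
    (hc₀ : 0 < c₀) :
    ∃ a C : ℝ, c < a ∧ 0 < C ∧ ∃ N : ℕ, ∀ n ≥ N, 3 ≤ n ∧
      ∀ (Ω : Type) [MeasurableSpace Ω] (P : Measure Ω) [IsProbabilityMeasure P]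
        (Y : Fin n → Ω → ℝ) (B β v F : ℝ), IsBoundedSample P Y B β v F → 0 < B →
        c₀ * (B ^ 2 * F) ≤ v + β ^ 2 →
        ∫ ω, (thresholdedMean γ B (fun i ↦ Y i ω) - β) ^ 2 ∂P ≤
          C * (min (β ^ 2) (Real.log n * (v / n))
            + (if 1 / 2 < F then B ^ 2 * F * (Real.log n / n) else 0)
            + β ^ 2 * Real.exp (-(a * Real.log n))
            + B ^ 2 * F * (Real.log n / n) * Real.exp (-(a * Real.log n))) := by
  have γ0 : 0 < γ := hc.trans hγ
  set τ := 1 - c / γ with hτ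
  have hcγ : c / γ < 1 := (div_lt_one γ0).2 hγ
  have hcγ0 : 0 < c / γ := by positivity
  have τ0 : 0 < τ := by linarith
  have τ1 : τ < 1 := by linarith
  set κ := 1 - τ / 4 with hκ
  set ε := τ / 8 with hε
  have hρ : 1 - τ < κ ^ 2 * (1 - 2 * ε) := by
    rw [hκ, hε]
    nlinarith [mul_pos τ0 τ0, mul_pos (mul_pos τ0 τ0) (sub_pos.2 τ1)]
  set a := κ ^ 2 * (1 - 2 * ε) * γ with ha
  have hca : c < a := by
    rw [hτ, sub_sub_cancel, div_lt_iff₀ γ0] at hρ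
    exact hρ
  have haγ : a ≤ γ := by
    have : κ ^ 2 * (1 - 2 * ε) ≤ 1 := by
      have h1 : κ ^ 2 ≤ 1 := by rw [hκ]; nlinarith
      have h2 : 0 ≤ ε := by positivity
      nlinarith [sq_nonneg κ]
    exact mul_le_of_le_one_left γ0.le this
  set Cκ := 4 / (1 - κ) ^ 2
  have hκ1 : 0 < 1 - κ := by rw [hκ]; linarith
  have Cκ0 : 0 < Cκ := by positivity
  set A := 16 * γ + 656 * γ / c₀ + 1 with hA
  have hA1 : 1 ≤ A := by
    have : 0 < 16 * γ + 656 * γ / c₀ := by positivity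
    linarith
  -- with this `K`, `n ^ (-K) ≤ (log n / n) ^ 2 * n ^ (-γ)` for `n ≥ 3`
  set K := γ + 2 with hK
  have K0 : 0 < K := by positivity
  -- the bound by `4 / γ` makes `F ≤ 1 / 2` for the rarely observed coefficients
  obtain ⟨N, hN⟩ := eventually_atTop.1 ((tendsto_log_div_natCast.eventually_le_const
    (u := min (ε ^ 2 / 16 / γ) (4 / γ)) (lt_min (by positivity) (by positivity))).and
      (eventually_ge_atTop 3))
  refine ⟨a, Cκ * (A + 328 * γ) + 5 + (20 * K + 40 * K ^ 2 / γ + 64 / γ) + (γ / 4 + 1) + 112,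
    hca, by positivity, N, fun n hn ↦ ⟨(hN n hn).2, ?_⟩⟩
  intro Ω _ P _ Y B β v F h hB hlow
  obtain ⟨hl, hn3⟩ := hN n hn
  have hn0 : 0 < n := by lia
  have hn' : (0 : ℝ) < n := by exact_mod_cast hn0
  have hn3' : (3 : ℝ) ≤ n := by exact_mod_cast hn3
  have hlog1 : 1 ≤ Real.log n := by
    rw [Real.le_log_iff_exp_le hn']
    linarith [Real.exp_one_lt_d9]
  have hl1 : γ * (Real.log n / n) ≤ ε ^ 2 / 16 := by
    have := hl.trans (min_le_left _ _)
    rw [le_div_iff₀ γ0] at this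
    linarith
  have hl2 : γ / 8 * (Real.log n / n) ≤ 1 / 2 := by
    have := hl.trans (min_le_right _ _)
    rw [le_div_iff₀ γ0] at this
    linarith
  have hv := h.variance_nonneg hn0
  have F0 := h.prob_nonneg hn0
  have hCS := h.sq_mean_le hn0
  have hsm := h.second_moment_le hn0
  have hlv : Real.log n * (v / n) = Real.log n / n * v := by ring
  have hn1 : 1 / (n : ℝ) ≤ Real.log n / n := by gcongr
  rw [hlv]
  have hexp : Real.exp (-(γ * Real.log n)) ≤ Real.exp (-(a * Real.log n)) := by
    rw [Real.exp_le_exp, neg_le_neg_iff]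
    gcongr
  set E := Real.exp (-(a * Real.log n)) with hE
  have E0 : 0 < E := Real.exp_pos _
  have l0 : 0 < Real.log n / n := by positivity
  set t₁ := min (β ^ 2) (Real.log n / n * v)
  set t₂ := (if 1 / 2 < F then B ^ 2 * F * (Real.log n / n) else 0) with ht₂
  set t₄ := B ^ 2 * F * (Real.log n / n) * E with ht₄
  have t₁0 : 0 ≤ t₁ := le_min (sq_nonneg _) (by positivity)
  have t₂0 : 0 ≤ t₂ := by rw [ht₂]; split_ifs <;> positivity
  have t₃0 : 0 ≤ β ^ 2 * E := by positivity
  have t₄0 : 0 ≤ t₄ := by positivity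
  have c1 : 0 ≤ Cκ * (A + 328 * γ) := by positivity
  have c3 : 0 ≤ 20 * K + 40 * K ^ 2 / γ + 64 / γ := by positivity
  have combine : ∀ {x₁ x₂ x₃ x₄ C : ℝ}, x₁ ≤ C → x₂ ≤ C → x₃ ≤ C → x₄ ≤ C →
      x₁ * t₁ + x₂ * t₂ + x₃ * (β ^ 2 * E) + x₄ * t₄ ≤ C * (t₁ + t₂ + β ^ 2 * E + t₄) := by
    intro x₁ x₂ x₃ x₄ C h₁ h₂ h₃ h₄
    rw [mul_add, mul_add, mul_add]
    gcongr
  have halfβ : F ≤ 1 / 2 → β ^ 2 ≤ v := by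
    intro hF
    have := mul_le_mul_of_nonneg_left hF (by positivity : 0 ≤ v + β ^ 2)
    linarith
  rcases le_or_gt F (γ / 8 * (Real.log n / n)) with hF | hF
  · -- rarely observed coefficients
    have hnF : n * F ≤ γ / 8 * Real.log n := by
      have := mul_le_mul_of_nonneg_left hF hn'.le
      refine this.trans (le_of_eq ?_)
      field_simp
    refine (h.integral_thresholdedMean_sub_sq_le_of_rare hn3 hB γ0 hnF).trans ?_
    have hβv := halfβ (hF.trans hl2)
    have h1 : β ^ 2 ≤ (γ / 4 + 1) * t₁ := by
      have h2 : β ^ 2 ≤ (γ / 4 + 1) * (Real.log n / n * v) := by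
        have := mul_le_mul_of_nonneg_left hF (by positivity : 0 ≤ v + β ^ 2)
        have h3 : (v + β ^ 2) * (γ / 8 * (Real.log n / n))
            ≤ (v + v) * (γ / 8 * (Real.log n / n)) := by gcongr
        have h4 : (v + v) * (γ / 8 * (Real.log n / n)) = γ / 4 * (Real.log n / n * v) := by ring
        have h5 : 0 ≤ Real.log n / n * v := by positivity
        linarith
      calc β ^ 2 = min (β ^ 2) (β ^ 2) := (min_self _).symm
        _ ≤ (γ / 4 + 1) * t₁ := min_le_mul_min (sq_nonneg _) (by linarith) h2
    have h2 : B ^ 2 * F / n * Real.exp (-(3 * γ * Real.log n)) ≤ t₄ := by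
      have : Real.exp (-(3 * γ * Real.log n)) ≤ E := by
        refine le_trans ?_ hexp
        rw [Real.exp_le_exp, neg_le_neg_iff]
        gcongr
        linarith
      rw [ht₄, div_eq_mul_one_div]
      gcongr
    refine le_trans ?_ (combine (x₁ := γ / 4 + 1) (x₂ := 0) (x₃ := 0) (x₄ := 112)
      (by linarith) (by linarith) (by linarith) (by linarith))
    linarith
  · -- a factor `F` may be inserted into every term containing `B ^ 2`
    have hBl : B ^ 2 * (Real.log n / n) ≤ 8 / γ * (B ^ 2 * F) := by
      have : Real.log n / n ≤ 8 / γ * F := by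
        rw [div_mul_eq_mul_div, le_div_iff₀ γ0]
        linarith
      calc B ^ 2 * (Real.log n / n) ≤ B ^ 2 * (8 / γ * F) := by gcongr
        _ = 8 / γ * (B ^ 2 * F) := by ring
    refine (h.integral_thresholdedMean_sub_sq_le (κ := κ) (ε := ε) hn3 hB γ0 (by rw [hκ]; linarith)
      (by linarith) (by positivity) (by rw [hε]; linarith) K0 hl1).trans ?_
    rw [← ha, ← hE]
    set l := Real.log n / n
    have hBl2 : γ ^ 2 * B ^ 2 * l ^ 2 ≤ 8 * γ * (B ^ 2 * F * l) := by
      have := mul_le_mul_of_nonneg_left hBl (by positivity : 0 ≤ γ ^ 2 * l)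
      have e : γ ^ 2 * l * (8 / γ * (B ^ 2 * F)) = 8 * γ * (B ^ 2 * F * l) := by field_simp
      rw [e] at this
      linarith
    have hmin : min (β ^ 2) (16 * γ * l * v + 41 * γ ^ 2 * B ^ 2 * l ^ 2)
        ≤ A * t₁ + 328 * γ * t₂ := by
      rcases le_or_gt F (1 / 2) with hF2 | hF2
      · have h1 : B ^ 2 * F * l ≤ 2 / c₀ * (l * v) := by
          rw [div_mul_eq_mul_div, le_div_iff₀ hc₀]
          have h2 : v + β ^ 2 ≤ 2 * v := by linarith [halfβ hF2]
          calc B ^ 2 * F * l * c₀ = l * (c₀ * (B ^ 2 * F)) := by ring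
            _ ≤ l * (2 * v) := mul_le_mul_of_nonneg_left (hlow.trans h2) l0.le
            _ = 2 * (l * v) := by ring
        have h2 : 16 * γ * l * v + 41 * γ ^ 2 * B ^ 2 * l ^ 2 ≤ A * (l * v) := by
          have h3 := mul_le_mul_of_nonneg_left h1 (by positivity : 0 ≤ 328 * γ)
          have e : 328 * γ * (2 / c₀ * (l * v)) = 656 * γ / c₀ * (l * v) := by ring
          rw [e] at h3
          have h5 : A * (l * v) = 16 * γ * l * v + 656 * γ / c₀ * (l * v) + l * v := by
            rw [hA]; ring
          have h6 : 0 ≤ l * v := by positivity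
          linarith
        have h4 := min_le_mul_min (sq_nonneg β) hA1 h2
        have : 0 ≤ 328 * γ * t₂ := by positivity
        linarith
      · rw [ht₂, if_pos hF2]
        have h2 : 16 * γ * l * v ≤ A * (l * v) := by
          have : 0 ≤ 656 * γ / c₀ * (l * v) := by positivity
          have h5 : A * (l * v) = 16 * γ * l * v + 656 * γ / c₀ * (l * v) + l * v := by
            rw [hA]; ring
          have h6 : 0 ≤ l * v := by positivity
          linarith
        have h4 := min_le_mul_min (sq_nonneg β) hA1 h2
        have h5 : min (β ^ 2) (16 * γ * l * v + 41 * γ ^ 2 * B ^ 2 * l ^ 2)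
            ≤ min (β ^ 2) (16 * γ * l * v) + 41 * γ ^ 2 * B ^ 2 * l ^ 2 := by
          have hp : 0 ≤ 41 * γ ^ 2 * B ^ 2 * l ^ 2 := by positivity
          rw [← min_add_add_right]
          exact min_le_min (by linarith) le_rfl
        linarith
    have hdev : 4 * K * v * l + K ^ 2 * B ^ 2 * l ^ 2
        ≤ (4 * K + 8 * K ^ 2 / γ) * (B ^ 2 * F * l) := by
      have h1 : v ≤ B ^ 2 * F := by linarith [sq_nonneg β]
      have h2 : 4 * K * v * l ≤ 4 * K * (B ^ 2 * F) * l := by gcongr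
      have h3 := mul_le_mul_of_nonneg_left hBl (by positivity : 0 ≤ K ^ 2 * l)
      have e : K ^ 2 * l * (8 / γ * (B ^ 2 * F)) = 8 * K ^ 2 / γ * (B ^ 2 * F * l) := by ring
      rw [e] at h3
      linarith
    have hfar : B ^ 2 * Real.exp (-(K * Real.log n)) ≤ 8 / γ * t₄ := by
      have h1 : Real.exp (-(K * Real.log n)) ≤ l ^ 2 * E := by
        have e : Real.exp (-(K * Real.log n))
            = (1 / (n : ℝ)) ^ 2 * Real.exp (-(γ * Real.log n)) := by
          rw [hK, add_mul, neg_add, Real.exp_add, mul_comm, one_div,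
            show -(2 * Real.log n) = Real.log ((n : ℝ)⁻¹ ^ 2) by
              rw [Real.log_pow, Real.log_inv]; push_cast; ring,
            Real.exp_log (by positivity)]
        rw [e]
        gcongr
      calc B ^ 2 * Real.exp (-(K * Real.log n)) ≤ B ^ 2 * (l ^ 2 * E) := by gcongr
        _ = (B ^ 2 * l) * (l * E) := by ring
        _ ≤ (8 / γ * (B ^ 2 * F)) * (l * E) := by gcongr
        _ = 8 / γ * t₄ := by rw [ht₄]; ring
    have hmin' := mul_le_mul_of_nonneg_left hmin Cκ0.le
    have hdev' := mul_le_mul_of_nonneg_right hdev E0.le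
    have q1 : 0 ≤ Cκ * (328 * γ) := by positivity
    have q2 : 0 ≤ Cκ * A := by positivity
    have q3 : Cκ * (A + 328 * γ) = Cκ * A + Cκ * (328 * γ) := by ring
    refine le_trans ?_ (combine (x₁ := Cκ * A) (x₂ := Cκ * (328 * γ)) (x₃ := 5)
      (x₄ := 20 * K + 40 * K ^ 2 / γ + 64 / γ)
      (by linarith) (by linarith) (by linarith) (by linarith))
    have e1 : (4 * K + 8 * K ^ 2 / γ) * (B ^ 2 * F * l) * E = (4 * K + 8 * K ^ 2 / γ) * t₄ := by
      rw [ht₄]; ring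
    rw [e1] at hdev'
    have e2 : (20 * K + 40 * K ^ 2 / γ + 64 / γ) * t₄
        = 5 * ((4 * K + 8 * K ^ 2 / γ) * t₄) + 8 * (8 / γ * t₄) := by ring
    rw [e2]
    linarith

/-! ### Dilated and translated wavelets -/

/-- The dilation factor of the index `(j, k)`: `1` for `j = -1` and `2 ^ j` for `j ≥ 0`. -/
noncomputable def dilation (j : ℤ) : ℝ := if j = -1 then 1 else 2 ^ j

lemma dilation_pos (j : ℤ) : 0 < dilation j := by
  unfold dilation; split_ifs <;> positivity

lemma dilation_le (j : ℤ) (hj : -1 ≤ j) : dilation j ≤ 2 * 2 ^ j := by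
  unfold dilation
  split_ifs with h
  · subst h; norm_num
  · have : (0 : ℝ) < 2 ^ j := by positivity
    linarith

lemma le_dilation (j : ℤ) : (2 : ℝ) ^ j ≤ dilation j := by
  unfold dilation
  split_ifs with h
  · subst h; norm_num
  · exact le_rfl

lemma wavelet_eq (g h : ℝ → ℝ) (p : ℤ × ℤ) (x : ℝ) :
    wavelet g h p x =
      √(dilation p.1) * (if p.1 = -1 then g else h) (dilation p.1 * x - p.2) := by
  unfold wavelet dilation
  split_ifs with hp
  · simp
  · rw [Real.sqrt_eq_rpow, ← Real.rpow_intCast, ← Real.rpow_mul (by norm_num), mul_one_div,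
      Real.rpow_intCast]

/-- A measurable function bounded by `M` that vanishes outside `[-A, A]`. -/
structure IsBump (A M : ℝ) (b : ℝ → ℝ) : Prop where
  meas : Measurable b
  bound : ∀ x, |b x| ≤ M
  supp : ∀ x, b x ≠ 0 → |x| ≤ A

lemma IsBump.mono {A M A' M' : ℝ} {b : ℝ → ℝ} (h : IsBump A M b) (hA : A ≤ A') (hM : M ≤ M') :
    IsBump A' M' b :=
  ⟨h.meas, fun x ↦ (h.bound x).trans hM, fun x hx ↦ (h.supp x hx).trans hA⟩

lemma IsBump.ite {A M : ℝ} {g h : ℝ → ℝ} (hg : IsBump A M g) (hh : IsBump A M h) (q : Prop)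
    [Decidable q] : IsBump A M (if q then g else h) := by
  split_ifs <;> assumption

lemma exists_isBump {b : ℝ → ℝ} (hm : Measurable b) (hb : ∃ M, ∀ x, |b x| ≤ M)
    (hs : HasCompactSupport b) : ∃ A M, IsBump A M b := by
  obtain ⟨M, hM⟩ := hb
  obtain ⟨A, hA⟩ := hs.isBounded.exists_norm_le
  exact ⟨A, M, hm, hM, fun x hx ↦ hA x (subset_tsupport b hx)⟩

section Wavelet

variable {A M : ℝ} {g h : ℝ → ℝ} (hg : IsBump A M g) (hh : IsBump A M h)
include hg hh

lemma measurable_wavelet (p : ℤ × ℤ) : Measurable (wavelet g h p) := by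
  have h1 : wavelet g h p = fun x ↦ √(dilation p.1) *
      (if p.1 = -1 then g else h) (dilation p.1 * x - p.2) := funext (wavelet_eq g h p)
  rw [h1]
  exact ((hg.ite hh _).meas.comp (by fun_prop)).const_mul _

lemma abs_wavelet_le (p : ℤ × ℤ) (x : ℝ) : |wavelet g h p x| ≤ M * √(dilation p.1) := by
  rw [wavelet_eq, abs_mul, abs_of_nonneg (Real.sqrt_nonneg _), mul_comm]
  exact mul_le_mul_of_nonneg_right ((hg.ite hh _).bound _) (Real.sqrt_nonneg _)

lemma abs_le_of_wavelet_ne_zero {p : ℤ × ℤ} {x : ℝ} (hx : wavelet g h p x ≠ 0) :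
    |dilation p.1 * x - p.2| ≤ A := by
  rw [wavelet_eq] at hx
  exact (hg.ite hh _).supp _ (right_ne_zero_of_mul hx)

lemma support_wavelet_subset (p : ℤ × ℤ) : {x | wavelet g h p x ≠ 0} ⊆
    Set.Icc ((p.2 - A) / dilation p.1) ((p.2 + A) / dilation p.1) := by
  intro x hx
  have h1 := abs_le.1 (abs_le_of_wavelet_ne_zero hg hh hx)
  have h2 := dilation_pos p.1
  constructor
  · rw [div_le_iff₀ h2]; linarith
  · rw [le_div_iff₀ h2]; linarith

lemma volume_support_wavelet_le (p : ℤ × ℤ) :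
    volume {x | wavelet g h p x ≠ 0} ≤ ENNReal.ofReal (2 * A / dilation p.1) := by
  refine (measure_mono (support_wavelet_subset hg hh p)).trans (le_of_eq ?_)
  rw [Real.volume_Icc]
  congr 1
  ring

lemma measurableSet_support_wavelet (p : ℤ × ℤ) : MeasurableSet {x | wavelet g h p x ≠ 0} :=
  (measurable_wavelet hg hh p (measurableSet_singleton 0)).compl

lemma integrable_wavelet_sq (p : ℤ × ℤ) : Integrable (fun x ↦ wavelet g h p x ^ 2) := by
  refine Integrable.mono' (g := {x | wavelet g h p x ≠ 0}.indicator
    fun _ ↦ (M * √(dilation p.1)) ^ 2) ?_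
    ((measurable_wavelet hg hh p).pow_const 2).aestronglyMeasurable (ae_of_all _ fun x ↦ ?_)
  · rw [integrable_indicator_iff (measurableSet_support_wavelet hg hh p)]
    exact integrableOn_const
      ((volume_support_wavelet_le hg hh p).trans_lt ENNReal.ofReal_lt_top).ne
  · by_cases hx : wavelet g h p x = 0
    · simp [hx]
    · rw [Set.indicator_of_mem (by exact hx), Real.norm_eq_abs, abs_pow]
      exact pow_le_pow_left₀ (abs_nonneg _) (abs_wavelet_le hg hh p x) 2

lemma memLp_wavelet (p : ℤ × ℤ) : MemLp (wavelet g h p) 2 volume :=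
  (memLp_two_iff_integrable_sq (measurable_wavelet hg hh p).aestronglyMeasurable).2
    (integrable_wavelet_sq hg hh p)

lemma integral_wavelet_sq_le (hA : 0 ≤ A) (p : ℤ × ℤ) :
    ∫ x, wavelet g h p x ^ 2 ≤ 2 * A * M ^ 2 := by
  have hd := dilation_pos p.1
  have hfin := ((volume_support_wavelet_le hg hh p).trans_lt ENNReal.ofReal_lt_top).ne
  calc ∫ x, wavelet g h p x ^ 2
      ≤ ∫ x, {x | wavelet g h p x ≠ 0}.indicator (fun _ ↦ (M * √(dilation p.1)) ^ 2) x := by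
        refine integral_mono (integrable_wavelet_sq hg hh p) ?_ fun x ↦ ?_
        · rw [integrable_indicator_iff (measurableSet_support_wavelet hg hh p)]
          exact integrableOn_const hfin
        · by_cases hx : wavelet g h p x = 0
          · simp [hx]
          · rw [Set.indicator_of_mem (by exact hx), ← sq_abs]
            exact pow_le_pow_left₀ (abs_nonneg _) (abs_wavelet_le hg hh p x) 2
    _ = volume.real {x | wavelet g h p x ≠ 0} * (M ^ 2 * dilation p.1) := by
        rw [integral_indicator_const _ (measurableSet_support_wavelet hg hh p), mul_pow,
          Real.sq_sqrt hd.le, smul_eq_mul]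
    _ ≤ 2 * A / dilation p.1 * (M ^ 2 * dilation p.1) := by
        gcongr
        exact ENNReal.toReal_le_of_le_ofReal (by positivity) (volume_support_wavelet_le hg hh p)
    _ = 2 * A * M ^ 2 := by field_simp

/-- At each level, the supports of the wavelets have bounded overlap. -/
lemma tsum_indicator_support_le (hA : 0 ≤ A) (j : ℤ) (x : ℝ) :
    ∑' k : ℤ, {x | wavelet g h (j, k) x ≠ 0}.indicator (fun _ ↦ (1 : ENNReal)) x
      ≤ ENNReal.ofReal (2 * A + 1) := by
  set y := dilation j * x
  rw [tsum_eq_sum (s := Finset.Icc ⌈y - A⌉ ⌊y + A⌋)]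
  · refine (Finset.sum_le_sum (g := fun _ ↦ (1 : ENNReal)) fun k _ ↦
      Set.indicator_le_self' (fun _ _ ↦ zero_le_one) x).trans ?_
    rw [Finset.sum_const, nsmul_eq_mul, mul_one, Int.card_Icc, ← ENNReal.ofReal_natCast]
    refine ENNReal.ofReal_le_ofReal ?_
    have h1 := Int.floor_le (y + A)
    have h2 := Int.le_ceil (y - A)
    have h3 : (((⌊y + A⌋ + 1 - ⌈y - A⌉).toNat : ℤ) : ℝ)
        = ((max (⌊y + A⌋ + 1 - ⌈y - A⌉) 0 : ℤ) : ℝ) := by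
      rw [Int.toNat_eq_max]
    rw [Int.cast_natCast] at h3
    rw [h3]
    push_cast
    exact max_le (by linarith) (by linarith)
  · intro k hk
    refine Set.indicator_of_notMem (fun hx ↦ hk ?_) _
    have h1 := abs_le.1 (abs_le_of_wavelet_ne_zero hg hh hx)
    rw [Finset.mem_Icc, Int.ceil_le, Int.le_floor]
    exact ⟨by linarith [h1.2], by linarith [h1.1]⟩

lemma tsum_measure_support_le (hA : 0 ≤ A) (μ : Measure ℝ) [IsProbabilityMeasure μ] (j : ℤ) :
    ∑' k : ℤ, μ {x | wavelet g h (j, k) x ≠ 0} ≤ ENNReal.ofReal (2 * A + 1) := by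
  have h1 : ∀ k : ℤ, μ {x | wavelet g h (j, k) x ≠ 0}
      = ∫⁻ x, {x | wavelet g h (j, k) x ≠ 0}.indicator (fun _ ↦ (1 : ENNReal)) x ∂μ := by
    intro k
    rw [lintegral_indicator_const (measurableSet_support_wavelet hg hh _), one_mul]
  simp_rw [h1]
  rw [← lintegral_tsum fun k ↦ (measurable_const.indicator
    (measurableSet_support_wavelet hg hh (j, k))).aemeasurable]
  refine (lintegral_mono (tsum_indicator_support_le hg hh hA j)).trans ?_
  simp

end Wavelet

/-! ### Piecewise constant functions -/

/-- The relative position of `x` with respect to the breakpoints determines the value of a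
piecewise constant function; there are finitely many such positions. -/
lemma IsPiecewiseConstant.measurable_and_finite_range {g : ℝ → ℝ} (hg : IsPiecewiseConstant g) :
    Measurable g ∧ (Set.range g).Finite := by
  obtain ⟨t, ht⟩ := hg
  classical
  let G : ℝ → t → Prop × Prop := fun x z ↦ (z.1 < x, z.1 ≤ x)
  have key : ∀ x y, x ≤ y → G x = G y → g x = g y := by
    intro x y hxy hG
    rcases hxy.eq_or_lt with rfl | hlt
    · rfl
    · refine ht x y hxy fun z hz hzt ↦ ?_
      have h1 := congrFun hG ⟨z, hzt⟩
      simp only [G, Prod.mk.injEq, eq_iff_iff] at h1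
      have h2 : z ≤ x := h1.2.2 hz.2
      have h3 : z = x := le_antisymm h2 hz.1
      exact absurd (h1.1.2 (h3 ▸ hlt)) (by rw [h3]; exact lt_irrefl x)
  have hfac : ∀ x y, G x = G y → g x = g y := fun x y hG ↦
    (le_total x y).elim (fun h ↦ key x y h hG) fun h ↦ (key y x h hG.symm).symm
  have hcomp : g = Function.extend G g 0 ∘ G := by
    ext x
    rw [Function.comp_apply, Function.FactorsThrough.extend_apply (fun a b ↦ hfac a b)]
  have hGm : Measurable G := by
    refine measurable_pi_lambda _ fun z ↦ Measurable.prodMk ?_ ?_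
    · exact measurableSet_setOfPred.1 (measurableSet_Ioi (a := z.1))
    · exact measurableSet_setOfPred.1 (measurableSet_Ici (a := z.1))
  constructor
  · rw [hcomp]
    exact (measurable_of_finite _).comp hGm
  · rw [hcomp]
    exact (Set.finite_range _).subset (Set.range_comp_subset_range _ _)

lemma exists_bounds_of_finite_range {g : ℝ → ℝ} (hg : (Set.range g).Finite) :
    ∃ m M : ℝ, 0 < m ∧ (∀ x, |g x| ≤ M) ∧ ∀ x, g x ≠ 0 → m ≤ |g x| := by
  have hfin : (Set.range fun x ↦ |g x|).Finite := by
    rw [Set.range_comp' abs g]; exact hg.image _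
  obtain ⟨M, hM⟩ := hfin.bddAbove
  have hM' : ∀ x, |g x| ≤ M := fun x ↦ hM ⟨x, rfl⟩
  rcases ((Set.range fun x ↦ |g x|) \ {0}).eq_empty_or_nonempty with h0 | h0
  · refine ⟨1, M, one_pos, hM', fun x hx ↦ ?_⟩
    have : |g x| ∈ (Set.range fun x ↦ |g x|) \ {0} := ⟨⟨x, rfl⟩, by simpa using hx⟩
    rw [h0] at this
    exact this.elim
  · obtain ⟨m, hm, hmin⟩ := Set.exists_min_image _ id (hfin.subset Set.sdiff_subset) h0
    obtain ⟨⟨x, rfl⟩, hx⟩ := hm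
    refine ⟨|g x|, M, abs_pos.2 (by simpa using hx), hM', fun y hy ↦ ?_⟩
    exact hmin |g y| ⟨⟨y, rfl⟩, by simpa using hy⟩

/-! ### The wavelet basis as a frame of `L²` -/

lemma isBump_phi : IsBump 1 1 phi := by
  refine ⟨measurable_one.indicator measurableSet_Icc, fun x ↦ ?_, fun x hx ↦ ?_⟩
  · unfold phi
    by_cases hx : x ∈ Set.Icc (0 : ℝ) 1 <;> simp [hx]
  · have : x ∈ Set.Icc (0 : ℝ) 1 := Set.mem_of_indicator_ne_zero hx
    rw [abs_of_nonneg this.1]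
    exact this.2

lemma one_le_abs_phi {x : ℝ} (hx : phi x ≠ 0) : 1 ≤ |phi x| := by
  have : x ∈ Set.Icc (0 : ℝ) 1 := Set.mem_of_indicator_ne_zero hx
  simp [phi, this]

lemma isBump_haar : IsBump 1 2 haar := by
  refine ⟨(measurable_one.indicator measurableSet_Ico).sub
    (measurable_one.indicator measurableSet_Icc), fun x ↦ ?_, fun x hx ↦ ?_⟩
  · have h : ∀ s : Set ℝ, |s.indicator (1 : ℝ → ℝ) x| ≤ 1 := fun s ↦ by
      by_cases hx : x ∈ s <;> simp [hx]
    exact (abs_sub _ _).trans (by linarith [h (Set.Ico (0 : ℝ) (1 / 2)), h (Set.Icc (1 / 2) 1)])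
  · by_contra hlt
    have h1 : x ∉ Set.Ico (0 : ℝ) (1 / 2) := fun h ↦ hlt (by
      rw [abs_of_nonneg h.1]; linarith [h.2])
    have h2 : x ∉ Set.Icc (1 / 2 : ℝ) 1 := fun h ↦ hlt (by
      rw [abs_of_nonneg (by linarith [h.1])]; exact h.2)
    exact hx (by simp only [haar, Pi.sub_apply, Set.indicator_of_notMem h1,
      Set.indicator_of_notMem h2, sub_zero])

/-- Quantitative data of a biorthogonal basis: all four generators are bounded by `M` and supported
in `[-A, A]`, and the decomposition generators are at least `m` where they do not vanish. -/
structure HasBounds (A M m : ℝ) (psi phit psit : ℝ → ℝ) : Prop where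
  A_pos : 0 < A
  M_pos : 0 < M
  m_pos : 0 < m
  phi_bump : IsBump A M phi
  psi_bump : IsBump A M psi
  phit_bump : IsBump A M phit
  psit_bump : IsBump A M psit
  le_phi : ∀ x, phi x ≠ 0 → m ≤ |phi x|
  le_psi : ∀ x, psi x ≠ 0 → m ≤ |psi x|

lemma IsHolder.exists_isBump {s : ℝ} {b : ℝ → ℝ} (hb : IsHolder s b) (hs : HasCompactSupport b) :
    ∃ A M, IsBump A M b := by
  have hc : Continuous b := hb.1.continuous
  refine WaveletThresholding.exists_isBump hc.measurable ?_ hs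
  obtain ⟨C, hC⟩ := hs.exists_bound_of_continuous hc
  exact ⟨C, hC⟩

lemma IsBiorthogonalWaveletBasis.exists_hasBounds {r : ℝ} {psi phit psit : ℝ → ℝ}
    (hb : IsBiorthogonalWaveletBasis r psi phit psit) :
    ∃ A M m, HasBounds A M m psi phit psit := by
  obtain ⟨hpm, hpf⟩ := hb.piecewise_psi.measurable_and_finite_range
  obtain ⟨m, M₀, hm, hM₀, hlow⟩ := exists_bounds_of_finite_range hpf
  obtain ⟨A₁, M₁, h₁⟩ := exists_isBump hpm ⟨M₀, hM₀⟩ hb.compact_psi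
  have h23 : (∃ A M, IsBump A M phit) ∧ ∃ A M, IsBump A M psit := by
    rcases hb.regularity with ⟨-, h2, h3⟩ | ⟨-, -, h2, h3⟩
    · exact ⟨h2.exists_isBump hb.compact_phit, h3.exists_isBump hb.compact_psit⟩
    · exact ⟨⟨1, 1, h2 ▸ isBump_phi⟩, ⟨1, 2, h3 ▸ isBump_haar⟩⟩
  obtain ⟨⟨A₂, M₂, h₂⟩, A₃, M₃, h₃⟩ := h23
  refine ⟨max 1 (max A₁ (max A₂ A₃)), max 1 (max M₁ (max M₂ M₃)), min 1 m,
    by positivity, by positivity, by positivity, isBump_phi.mono ?_ ?_, h₁.mono ?_ ?_,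
    h₂.mono ?_ ?_, h₃.mono ?_ ?_, fun x hx ↦ (min_le_left _ _).trans (one_le_abs_phi hx),
    fun x hx ↦ (min_le_right _ _).trans (hlow x hx)⟩ <;> simp

section Frame

variable {r : ℝ} {psi phit psit : ℝ → ℝ}

lemma norm_toLp_sq {g : ℝ → ℝ} (hg : MemLp g 2 volume) :
    ‖hg.toLp g‖ ^ 2 = ∫ x, g x ^ 2 := by
  rw [← real_inner_self_eq_norm_sq, L2.inner_def]
  refine integral_congr_ae ?_
  filter_upwards [hg.coeFn_toLp] with x hx
  simp [hx, sq]

lemma inner_toLp {g h : ℝ → ℝ} (hg : MemLp g 2 volume) (hh : MemLp h 2 volume) :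
    inner ℝ (hg.toLp g) (hh.toLp h) = ∫ x, g x * h x := by
  rw [L2.inner_def]
  refine integral_congr_ae ?_
  filter_upwards [hg.coeFn_toLp, hh.coeFn_toLp] with x hx hx'
  simp [hx, hx', mul_comm]

lemma toLp_finsetSum {ι : Type*} {g : ι → ℝ → ℝ} (hg : ∀ i, MemLp (g i) 2 volume) (b : ι → ℝ)
    (s : Finset ι) (h : MemLp (fun x ↦ ∑ i ∈ s, b i * g i x) 2 volume) :
    h.toLp _ = ∑ i ∈ s, b i • (hg i).toLp (g i) := by
  classical
  induction s using Finset.induction_on with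
  | empty =>
    rw [Finset.sum_empty]
    exact (MemLp.toLp_congr h MemLp.zero (ae_of_all _ fun x ↦ by simp)).trans
      (MemLp.toLp_zero _)
  | insert a s ha ih =>
    have h1 : MemLp (fun x ↦ ∑ i ∈ s, b i * g i x) 2 volume :=
      memLp_finsetSum s fun i _ ↦ (hg i).const_mul (b i)
    rw [Finset.sum_insert ha, ← ih h1, ← MemLp.toLp_const_smul, ← MemLp.toLp_add]
    refine MemLp.toLp_congr _ _ (ae_of_all _ fun x ↦ ?_)
    simp [Finset.sum_insert ha]

/-- The Bessel inequality for the wavelet coefficients and the `ℓ²` bound on the error of a finite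
wavelet expansion. -/
theorem IsBiorthogonalWaveletBasis.exists_frame_bounds
    (hb : IsBiorthogonalWaveletBasis r psi phit psit) :
    ∃ K : ℝ, 0 < K ∧ ∀ f : ℝ → ℝ, MemLp f 2 volume →
      (∀ s : Finset Lam, ∑ p ∈ s, coef psi f p ^ 2 ≤ K * (eLpNorm f 2 volume).toReal ^ 2) ∧
      ∀ (s : Finset Lam) (d : Lam → ℝ), (∀ p ∉ s, d p = 0) →
        eLpNorm (fun y ↦ ∑ p ∈ s, d p * wavelet phit psit p y - f y) 2 volume ^ 2 ≤
          ENNReal.ofReal K * ∑' p : Lam, ENNReal.ofReal ((d p - coef psi f p) ^ 2) := by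
  obtain ⟨A, M, m, hB⟩ := hb.exists_hasBounds
  have mw : ∀ p : Lam, MemLp (wavelet phi psi p) 2 volume := fun p ↦
    memLp_wavelet hB.phi_bump hB.psi_bump p
  have mv : ∀ p : Lam, MemLp (wavelet phit psit p) 2 volume := fun p ↦
    memLp_wavelet hB.phit_bump hB.psit_bump p
  let w : Lam → Lp ℝ 2 (volume : Measure ℝ) := fun p ↦ (mw p).toLp _
  let v : Lam → Lp ℝ 2 (volume : Measure ℝ) := fun p ↦ (mv p).toLp _
  set T := 2 * A * M ^ 2
  have T0 : 0 < T := by have := hB.A_pos; have := hB.M_pos; positivity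
  have hw2 : ∀ p, ‖w p‖ ≤ √T := fun p ↦ Real.le_sqrt_of_sq_le <| by
    rw [norm_toLp_sq]; exact integral_wavelet_sq_le hB.phi_bump hB.psi_bump hB.A_pos.le p
  have hv2 : ∀ p, ‖v p‖ ≤ √T := fun p ↦ Real.le_sqrt_of_sq_le <| by
    rw [norm_toLp_sq]; exact integral_wavelet_sq_le hB.phit_bump hB.psit_bump hB.A_pos.le p
  -- by biorthogonality the product of the two norms is at least one
  have hwv : ∀ p, 1 ≤ ‖w p‖ * ‖v p‖ := fun p ↦ by
    have h1 := real_inner_le_norm (w p) (v p)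
    rw [inner_toLp, hb.biorthogonal p p.2 p p.2, if_pos rfl] at h1
    exact h1
  have hsT : 0 < √T := Real.sqrt_pos.2 T0
  have hw1 : ∀ p, 1 / √T ≤ ‖w p‖ := fun p ↦ by
    rw [div_le_iff₀ hsT]
    exact (hwv p).trans (by gcongr; exact hv2 p)
  have hv1 : ∀ p, 1 / √T ≤ ‖v p‖ := fun p ↦ by
    rw [div_le_iff₀ hsT, mul_comm]
    exact (hwv p).trans (by gcongr; exact hw2 p)
  have hsum : ∀ {f : ℝ → ℝ} (hf : MemLp f 2 volume),
      HasSum (fun p ↦ inner ℝ (w p) (hf.toLp f) • v p) (hf.toLp f) := by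
    intro f hf
    have h1 := hb.decomposition f hf
    rw [HasSum, tendsto_iff_edist_tendsto_0]
    refine h1.congr fun s ↦ ?_
    have h2 : MemLp (fun x ↦ ∑ p ∈ s, (∫ y, wavelet phi psi p y * f y) * wavelet phit psit p x)
        2 volume := memLp_finsetSum s fun p _ ↦ (mv p).const_mul _
    have h3 : ∑ p ∈ s, inner ℝ (w p) (hf.toLp f) • v p = h2.toLp _ := by
      rw [toLp_finsetSum mv]
      refine Finset.sum_congr rfl fun p _ ↦ ?_
      rw [inner_toLp]
    rw [h3, edist_comm, Lp.edist_toLp_toLp]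
    rfl
  obtain ⟨K, K0, hK1, hK2⟩ := exists_bessel_synthesis w v (fun g ↦ by
    have := hsum (Lp.memLp g)
    rwa [Lp.toLp_coeFn] at this) (by positivity) hw1 hv1
  refine ⟨K, K0, fun f hf ↦ ⟨fun s ↦ ?_, fun s d hd ↦ ?_⟩⟩
  · have h1 := hK1 s (hf.toLp f)
    rw [Lp.norm_toLp] at h1
    simpa only [w, inner_toLp, coef] using h1
  · have h1 : MemLp (fun x ↦ ∑ p ∈ s, d p * wavelet phit psit p x) 2 volume :=
      memLp_finsetSum s fun p _ ↦ (mv p).const_mul _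
    have hcoef : ∀ p : Lam, inner ℝ (w p) (hf.toLp f) = coef psi f p := fun p ↦ inner_toLp _ _
    have h2 : HasSum (fun p ↦ d p • v p) (h1.toLp _) := by
      rw [toLp_finsetSum mv]
      exact hasSum_sum_of_ne_finset_zero fun p hp ↦ by rw [hd p hp, zero_smul]
    have h3 := h2.sub (hsum hf)
    simp only [hcoef, ← sub_smul] at h3
    have h4 : eLpNorm (fun y ↦ ∑ p ∈ s, d p * wavelet phit psit p y - f y) 2 volume
        = ‖h1.toLp _ - hf.toLp f‖ₑ := by
      rw [← MemLp.toLp_sub, Lp.enorm_toLp]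
      rfl
    rw [h4]
    refine le_of_tendsto (((ENNReal.continuous_pow 2).tendsto _).comp
      (h3.enorm)) (Eventually.of_forall fun F ↦ ?_)
    simp only [Function.comp_apply]
    have h5 := hK2 F (fun p ↦ d p - coef psi f p)
    rw [← ofReal_norm, ← ENNReal.ofReal_pow (norm_nonneg _)]
    refine (ENNReal.ofReal_le_ofReal h5).trans ?_
    rw [ENNReal.ofReal_mul K0.le, ENNReal.ofReal_sum_of_nonneg fun p _ ↦ sq_nonneg _]
    gcongr
    exact ENNReal.sum_le_tsum F

end Frame

/-! ### Risk of one empirical wavelet coefficient -/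

/-- The distribution with density `f`. -/
noncomputable def densityMeasure (f : ℝ → ℝ) : Measure ℝ :=
  volume.withDensity fun x ↦ ENNReal.ofReal (f x)

section Density

variable {f : ℝ → ℝ} (hf : IsL2Density f)
include hf

lemma IsL2Density.isProbabilityMeasure : IsProbabilityMeasure (densityMeasure f) := by
  have hi : Integrable f := by
    by_contra hcon
    have := integral_undef hcon
    rw [hf.integral_eq_one] at this
    exact one_ne_zero this
  constructor
  rw [densityMeasure, withDensity_apply _ MeasurableSet.univ, Measure.restrict_univ,
    ← ofReal_integral_eq_lintegral_ofReal hi hf.nonneg, hf.integral_eq_one, ENNReal.ofReal_one]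

lemma IsL2Density.integral_densityMeasure (g : ℝ → ℝ) :
    ∫ x, g x ∂(densityMeasure f) = ∫ x, g x * f x := by
  rw [densityMeasure, integral_withDensity_eq_integral_toReal_smul₀
    hf.memLp.aestronglyMeasurable.aemeasurable.ennreal_ofReal
    (ae_of_all _ fun _ ↦ ENNReal.ofReal_lt_top)]
  refine integral_congr_ae ?_
  filter_upwards [hf.nonneg] with x hx
  rw [ENNReal.toReal_ofReal hx, smul_eq_mul, mul_comm]

/-- A square integrable density puts little mass on small sets. -/
lemma IsL2Density.measureReal_sq_le {s : Set ℝ} (hs : MeasurableSet s) {V : ℝ} (hV : 0 ≤ V)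
    (hsV : volume s ≤ ENNReal.ofReal V) :
    (densityMeasure f).real s ^ 2 ≤ (eLpNorm f 2 volume).toReal ^ 2 * V := by
  have h1 := eLpNorm_le_eLpNorm_mul_rpow_measure_univ (μ := volume.restrict s) (p := 1) (q := 2)
    (by norm_num) hf.memLp.aestronglyMeasurable.restrict
  have h2 : densityMeasure f s ≤ eLpNorm f 1 (volume.restrict s) := by
    rw [densityMeasure, withDensity_apply _ hs, eLpNorm_one_eq_lintegral_enorm]
    refine lintegral_mono fun x ↦ ?_
    rw [← ofReal_norm]
    exact ENNReal.ofReal_le_ofReal (Real.le_norm_self _)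
  have h3 : eLpNorm f 2 (volume.restrict s) ≤ eLpNorm f 2 volume :=
    eLpNorm_mono_measure _ Measure.restrict_le_self
  have h4 : densityMeasure f s ≤ eLpNorm f 2 volume * ENNReal.ofReal V ^ (1 / 2 : ℝ) := by
    refine h2.trans (h1.trans ?_)
    rw [Measure.restrict_apply_univ]
    norm_num
    gcongr
  have h5 : (densityMeasure f).real s ≤ (eLpNorm f 2 volume).toReal * √V := by
    have h6 := ENNReal.toReal_mono (ENNReal.mul_ne_top hf.memLp.2.ne
      (ENNReal.rpow_ne_top_of_nonneg (by norm_num) ENNReal.ofReal_ne_top)) h4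
    rwa [ENNReal.toReal_mul, ← ENNReal.toReal_rpow, ENNReal.toReal_ofReal hV,
      ← Real.sqrt_eq_rpow] at h6
  calc _ ≤ ((eLpNorm f 2 volume).toReal * √V) ^ 2 := pow_le_pow_left₀ measureReal_nonneg h5 2
    _ = _ := by rw [mul_pow, Real.sq_sqrt hV]

end Density

lemma betaTilde_eq (γ : ℝ) (psi : ℝ → ℝ) {n : ℕ} (x : Fin n → ℝ) (p : ℤ × ℤ) :
    betaTilde γ psi x p =
      thresholdedMean γ (supNorm psi p) fun i ↦ wavelet phi psi p (x i) := rfl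

section SupNorm

variable {A M m : ℝ} {psi phit psit : ℝ → ℝ} (hB : HasBounds A M m psi phit psit)
include hB

lemma HasBounds.supNorm_le (p : ℤ × ℤ) : supNorm psi p ≤ M * √(dilation p.1) :=
  ciSup_le fun x ↦ abs_wavelet_le hB.phi_bump hB.psi_bump p x

lemma HasBounds.abs_wavelet_le_supNorm (p : ℤ × ℤ) (x : ℝ) :
    |wavelet phi psi p x| ≤ supNorm psi p :=
  le_ciSup (f := fun x ↦ |wavelet phi psi p x|)
    ⟨M * √(dilation p.1), fun _ ⟨x, hx⟩ ↦ hx ▸ abs_wavelet_le hB.phi_bump hB.psi_bump p x⟩ x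

lemma HasBounds.supNorm_sq_le (p : ℤ × ℤ) : supNorm psi p ^ 2 ≤ M ^ 2 * dilation p.1 := by
  have h0 := (abs_nonneg _).trans (hB.abs_wavelet_le_supNorm p 0)
  calc supNorm psi p ^ 2 ≤ (M * √(dilation p.1)) ^ 2 := pow_le_pow_left₀ h0 (hB.supNorm_le p) 2
    _ = M ^ 2 * dilation p.1 := by rw [mul_pow, Real.sq_sqrt (dilation_pos _).le]

/-- Since `psi` takes finitely many values, a wavelet is of the order of its supremum norm wherever
it does not vanish. -/
lemma HasBounds.supNorm_sq_le_wavelet_sq {p : ℤ × ℤ} {x : ℝ} (hx : wavelet phi psi p x ≠ 0) :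
    (m / M) ^ 2 * supNorm psi p ^ 2 ≤ wavelet phi psi p x ^ 2 := by
  have hM := hB.M_pos
  have hm := hB.m_pos
  have h1 : m ^ 2 * dilation p.1 ≤ wavelet phi psi p x ^ 2 := by
    rw [wavelet_eq] at hx ⊢
    rw [mul_pow, Real.sq_sqrt (dilation_pos _).le, mul_comm]
    have hle : m ≤ |(if p.1 = -1 then phi else psi) (dilation p.1 * x - p.2)| := by
      have hne := right_ne_zero_of_mul hx
      split_ifs at hne ⊢
      · exact hB.le_phi _ hne
      · exact hB.le_psi _ hne
    have hd := dilation_pos p.1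
    rw [← sq_abs ((if p.1 = -1 then phi else psi) _)]
    gcongr
  calc (m / M) ^ 2 * supNorm psi p ^ 2 ≤ (m / M) ^ 2 * (M ^ 2 * dilation p.1) := by
        gcongr; exact hB.supNorm_sq_le p
    _ = m ^ 2 * dilation p.1 := by field_simp
    _ ≤ _ := h1

lemma HasBounds.isBoundedSample {f : ℝ → ℝ} (hf : IsL2Density f) (p : ℤ × ℤ) (n : ℕ)
    [IsProbabilityMeasure (densityMeasure f)] :
    IsBoundedSample (Measure.pi fun _ : Fin n ↦ densityMeasure f)
      (fun i x ↦ wavelet phi psi p (x i)) (supNorm psi p) (coef psi f p) (sigmaSq psi f p)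
      ((densityMeasure f).real {x | wavelet phi psi p x ≠ 0}) := by
  have hm : Measurable (wavelet phi psi p) := measurable_wavelet hB.phi_bump hB.psi_bump p
  refine ⟨iIndepFun_pi fun _ ↦ hm.aemeasurable, fun i ↦ hm.comp (measurable_pi_apply i),
    fun i x ↦ hB.abs_wavelet_le_supNorm p _, fun i ↦ ?_, fun i ↦ ?_, fun i ↦ ?_⟩
  · rw [integral_comp_eval (μ := fun _ : Fin n ↦ densityMeasure f) hm.aestronglyMeasurable,
      hf.integral_densityMeasure]
    rfl
  · rw [integral_comp_eval (μ := fun _ : Fin n ↦ densityMeasure f)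
      (f := fun x ↦ (wavelet phi psi p x - coef psi f p) ^ 2)
      ((hm.sub_const _).pow_const 2).aestronglyMeasurable]
    have h1 := integral_quadratic (P := densityMeasure f) hm.aemeasurable
      (hB.abs_wavelet_le_supNorm p) (coef psi f p ^ 2) (-2 * coef psi f p) 1
    rw [hf.integral_densityMeasure (wavelet phi psi p),
      hf.integral_densityMeasure (fun x ↦ wavelet phi psi p x ^ 2)] at h1
    have h2 : ∀ x, (wavelet phi psi p x - coef psi f p) ^ 2 = coef psi f p ^ 2
        + -2 * coef psi f p * wavelet phi psi p x + 1 * wavelet phi psi p x ^ 2 := fun x ↦ by ring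
    simp_rw [h2]
    rw [h1, sigmaSq, coef]
    ring
  · have h1 := (measurePreserving_eval (fun _ : Fin n ↦ densityMeasure f) i).measureReal_preimage
      (measurableSet_support_wavelet hB.phi_bump hB.psi_bump p).nullMeasurableSet
    exact h1

end SupNorm

/-- The mean squared error of one thresholded wavelet coefficient. Coefficients whose wavelet
carries more than half of the mass live at levels bounded in terms of `‖f‖₂`, which is why their
contribution comes with a factor decreasing in the level. -/
theorem IsBiorthogonalWaveletBasis.exists_integral_betaTilde_sub_sq_le {r : ℝ}
    {psi phit psit : ℝ → ℝ} (hb : IsBiorthogonalWaveletBasis r psi phit psit) {γ c : ℝ}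
    (hc : 0 < c) (hγ : c < γ) :
    ∃ a C : ℝ, c < a ∧ 0 < C ∧ ∃ N : ℕ, ∀ n ≥ N, 3 ≤ n ∧ ∀ f, IsL2Density f → ∀ p ∈ Lam,
      ∫⁻ x, ENNReal.ofReal ((betaTilde γ psi x p - coef psi f p) ^ 2)
          ∂(Measure.pi fun _ : Fin n ↦ densityMeasure f) ≤
        ENNReal.ofReal (C * (min (coef psi f p ^ 2) (Real.log n * (sigmaSq psi f p / n))
          + (eLpNorm f 2 volume).toReal ^ 4 * (Real.log n / n) *
            ((dilation p.1)⁻¹ * (densityMeasure f).real {x | wavelet phi psi p x ≠ 0})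
          + coef psi f p ^ 2 * Real.exp (-(a * Real.log n))
          + Real.log n / n * Real.exp (-(a * Real.log n)) *
            (dilation p.1 * (densityMeasure f).real {x | wavelet phi psi p x ≠ 0}))) := by
  obtain ⟨A, M, m, hB⟩ := hb.exists_hasBounds
  have hA := hB.A_pos
  have hM := hB.M_pos
  have hm := hB.m_pos
  obtain ⟨a, C, hca, C0, N, hN⟩ := exists_integral_thresholdedMean_sub_sq_le
    (c₀ := (m / M) ^ 2) hc hγ (by positivity)
  refine ⟨a, C * (1 + M ^ 2 + 64 * M ^ 2 * A ^ 2), hca, by positivity, N,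
    fun n hn ↦ ⟨(hN n hn).1, fun f hf p hp ↦ ?_⟩⟩
  have := hf.isProbabilityMeasure
  obtain ⟨hn3, hmain⟩ := hN n hn
  have hsample := hB.isBoundedSample hf p n
  have hn0 : 0 < n := by lia
  have hd := dilation_pos p.1
  have hsupp := measurableSet_support_wavelet hB.phi_bump hB.psi_bump p
  have hvol := volume_support_wavelet_le hB.phi_bump hB.psi_bump p
  have hwm : Measurable (wavelet phi psi p) := measurable_wavelet hB.phi_bump hB.psi_bump p
  have hpos : 0 < supNorm psi p := by
    by_contra! hle
    have hz : ∀ x, wavelet phi psi p x = 0 := fun x ↦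
      abs_nonpos_iff.1 ((hB.abs_wavelet_le_supNorm p x).trans hle)
    have h1 := hb.biorthogonal p hp p hp
    simp [hz] at h1
  have hsq : (m / M) ^ 2 * (supNorm psi p ^ 2 *
      (densityMeasure f).real {x | wavelet phi psi p x ≠ 0}) ≤
      sigmaSq psi f p + coef psi f p ^ 2 := by
    have h2 : sigmaSq psi f p + coef psi f p ^ 2
        = ∫ x, wavelet phi psi p x ^ 2 ∂(densityMeasure f) := by
      rw [hf.integral_densityMeasure, sigmaSq, coef]
      ring
    rw [h2]
    calc _ = ∫ x, {x | wavelet phi psi p x ≠ 0}.indicator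
          (fun _ ↦ (m / M) ^ 2 * supNorm psi p ^ 2) x ∂(densityMeasure f) := by
          rw [integral_indicator_const _ hsupp, smul_eq_mul]
          ring
      _ ≤ _ := by
          refine integral_mono ((integrable_const _).indicator hsupp)
            (integrable_of_abs_le (C := supNorm psi p ^ 2) (hwm.pow_const 2).aemeasurable
              fun x ↦ ?_) fun x ↦ ?_
          · rw [abs_pow]
            exact pow_le_pow_left₀ (abs_nonneg _) (hB.abs_wavelet_le_supNorm p x) 2
          · by_cases hx : wavelet phi psi p x = 0
            · simp [hx]
            · rw [Set.indicator_of_mem (by exact hx)]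
              exact hB.supNorm_sq_le_wavelet_sq hx
  have hrisk := hmain _ _ _ _ _ _ _ hsample hpos hsq
  have hlog : 0 < Real.log n := Real.log_pos (by exact_mod_cast (by lia : 1 < n))
  have hn' : (0 : ℝ) < n := by exact_mod_cast hn0
  have l0 : 0 < Real.log n / n := by positivity
  have hv := hsample.variance_nonneg hn0
  have hF2 := hf.measureReal_sq_le hsupp (by positivity) hvol
  have F0 : 0 ≤ (densityMeasure f).real {x | wavelet phi psi p x ≠ 0} := measureReal_nonneg
  simp_rw [betaTilde_eq]
  rw [← ofReal_integral_eq_lintegral_ofReal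
    (hsample.integrable_thresholdedMean_sub_sq hn0 γ) (ae_of_all _ fun _ ↦ sq_nonneg _)]
  refine ENNReal.ofReal_le_ofReal (hrisk.trans ?_)
  set F := (densityMeasure f).real {x | wavelet phi psi p x ≠ 0}
  set R := (eLpNorm f 2 volume).toReal
  set E := Real.exp (-(a * Real.log n))
  have E0 : 0 < E := Real.exp_pos _
  have hBd := hB.supNorm_sq_le p
  set β := coef psi f p
  set l := Real.log n / n
  set d := dilation p.1
  set B := supNorm psi p
  have t1 : 0 ≤ min (β ^ 2) (Real.log n * (sigmaSq psi f p / n)) :=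
    le_min (sq_nonneg _) (by positivity)
  have h2 : (if 1 / 2 < F then B ^ 2 * F * l else 0)
      ≤ 64 * M ^ 2 * A ^ 2 * (R ^ 4 * l * (d⁻¹ * F)) := by
    split_ifs with hF
    · have h3 : 1 ≤ 16 * (R ^ 2 * (2 * A / d)) ^ 2 := by
        have h4 : (1 / 2 : ℝ) ^ 2 ≤ F ^ 2 := pow_le_pow_left₀ (by norm_num) hF.le 2
        have h5 : (1 / 4 : ℝ) ≤ R ^ 2 * (2 * A / d) := by linarith
        have h6 := pow_le_pow_left₀ (by norm_num) h5 2
        linarith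
      calc B ^ 2 * F * l ≤ M ^ 2 * d * F * l := by gcongr
        _ ≤ M ^ 2 * d * F * l * (16 * (R ^ 2 * (2 * A / d)) ^ 2) :=
            le_mul_of_one_le_right (by positivity) h3
        _ = 64 * M ^ 2 * A ^ 2 * (R ^ 4 * l * (d⁻¹ * F)) := by field_simp; ring
    · positivity
  have h4 : B ^ 2 * F * l * E ≤ M ^ 2 * (l * E * (d * F)) := by
    calc B ^ 2 * F * l * E ≤ M ^ 2 * d * F * l * E := by gcongr
      _ = _ := by ring
  have t2 : 0 ≤ R ^ 4 * l * (d⁻¹ * F) := by positivity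
  have t3 : 0 ≤ β ^ 2 * E := by positivity
  have t4 : 0 ≤ l * E * (d * F) := by positivity
  have q1 : 0 ≤ M ^ 2 := by positivity
  have q2 : 0 ≤ M ^ 2 * A ^ 2 := by positivity
  rw [mul_assoc C]
  refine mul_le_mul_of_nonneg_left ?_ C0.le
  nlinarith [mul_nonneg q1 t1, mul_nonneg q1 t2, mul_nonneg q1 t3, mul_nonneg q2 t1,
    mul_nonneg q2 t3, mul_nonneg q2 t4]

/-! ### Summation over the index set -/

lemma tsum_indicator_Iic_two_zpow (J : ℤ) :
    ∑' j : ℤ, (Set.Iic J).indicator (fun j ↦ ENNReal.ofReal (2 ^ j)) j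
      = ENNReal.ofReal (2 * 2 ^ J) := by
  have hinj : Function.Injective fun i : ℕ ↦ J - i := fun i k h ↦ by
    simpa using h
  rw [← hinj.tsum_eq]
  · have h1 : ∀ i : ℕ, (Set.Iic J).indicator (fun j ↦ ENNReal.ofReal (2 ^ j)) (J - i)
        = ENNReal.ofReal (2 ^ J * (1 / 2) ^ i) := by
      intro i
      rw [Set.indicator_of_mem (by simp)]
      congr 1
      rw [zpow_sub₀ (by norm_num), zpow_natCast, one_div, inv_pow, div_eq_mul_inv]
    have hs := (hasSum_geometric_two).mul_left ((2 : ℝ) ^ J)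
    simp_rw [h1]
    rw [← ENNReal.ofReal_tsum_of_nonneg (fun i ↦ by positivity) hs.summable, hs.tsum_eq, mul_comm]
  · intro j hj
    have hj' : j ∈ Set.Iic J := Set.mem_of_indicator_ne_zero hj
    rw [Set.mem_Iic] at hj'
    exact ⟨(J - j).toNat, by simp [hj']⟩

lemma tsum_indicator_Ici_two_zpow_neg :
    ∑' j : ℤ, (Set.Ici (-1 : ℤ)).indicator (fun j ↦ ENNReal.ofReal (2 ^ (-j))) j
      = ENNReal.ofReal 4 := by
  rw [← (Equiv.neg ℤ).tsum_eq, show (4 : ℝ) = 2 * 2 ^ (1 : ℤ) by norm_num,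
    ← tsum_indicator_Iic_two_zpow]
  refine tsum_congr fun j ↦ ?_
  have h : -1 ≤ -j ↔ j ≤ 1 := by lia
  simp only [Set.indicator, Set.mem_Ici, Set.mem_Iic, Equiv.neg_apply, neg_neg, h]

/-- By bounded overlap, a sum over indices of masses weighted by functions of the level reduces to
a sum over levels. -/
lemma tsum_weight_mul_measure_le {A M : ℝ} {g h : ℝ → ℝ} (hg : IsBump A M g) (hh : IsBump A M h)
    (hA : 0 ≤ A) (μ : Measure ℝ) [IsProbabilityMeasure μ] {S : Set (ℤ × ℤ)} {J : Set ℤ}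
    (hS : ∀ p ∈ S, p.1 ∈ J) (q : ℤ → ENNReal) :
    ∑' p : S, q p.1.1 * μ {x | wavelet g h p x ≠ 0}
      ≤ (∑' j, J.indicator q j) * ENNReal.ofReal (2 * A + 1) := by
  rw [tsum_subtype S fun p ↦ q p.1 * μ {x | wavelet g h p x ≠ 0}]
  calc _ ≤ ∑' p : ℤ × ℤ, J.indicator q p.1 * μ {x | wavelet g h p x ≠ 0} := by
        refine ENNReal.tsum_le_tsum fun p ↦ ?_
        by_cases hp : p ∈ S
        · rw [Set.indicator_of_mem hp, Set.indicator_of_mem (hS p hp)]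
        · rw [Set.indicator_of_notMem hp]
          exact zero_le
    _ = ∑' j, J.indicator q j * ∑' k, μ {x | wavelet g h (j, k) x ≠ 0} := by
        rw [ENNReal.tsum_prod']
        simp_rw [ENNReal.tsum_mul_left]
    _ ≤ ∑' j, J.indicator q j * ENNReal.ofReal (2 * A + 1) := by
        gcongr with j
        exact tsum_measure_support_le hg hh hA μ j
    _ = _ := ENNReal.tsum_mul_right

lemma Gam_subset_Lam (c c' : ℝ) (n : ℕ) : Gam c c' n ⊆ Lam := fun _ hp ↦ hp.1

section Sums

variable {A M m : ℝ} {psi phit psit : ℝ → ℝ} (hB : HasBounds A M m psi phit psit)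
include hB

lemma HasBounds.tsum_inv_dilation_mul_le (μ : Measure ℝ) [IsProbabilityMeasure μ] (c c' : ℝ)
    (n : ℕ) : ∑' p : Gam c c' n, ENNReal.ofReal ((dilation p.1.1)⁻¹ *
      μ.real {x | wavelet phi psi p x ≠ 0}) ≤ ENNReal.ofReal (4 * (2 * A + 1)) := by
  rw [ENNReal.ofReal_mul (by norm_num), ← tsum_indicator_Ici_two_zpow_neg]
  refine le_trans (ENNReal.tsum_le_tsum fun p ↦ ?_)
    (tsum_weight_mul_measure_le hB.phi_bump hB.psi_bump hB.A_pos.le μ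
      (S := Gam c c' n) (J := Set.Ici (-1)) (fun p hp ↦ hp.1) _)
  rw [ENNReal.ofReal_mul (inv_nonneg.2 (dilation_pos _).le), ofReal_measureReal]
  gcongr
  rw [zpow_neg]
  have := le_dilation p.1.1
  gcongr

lemma HasBounds.tsum_dilation_mul_le (μ : Measure ℝ) [IsProbabilityMeasure μ] (c c' : ℝ)
    (n : ℕ) : ∑' p : Gam c c' n, ENNReal.ofReal (dilation p.1.1 *
      μ.real {x | wavelet phi psi p x ≠ 0})
        ≤ ENNReal.ofReal (4 * 2 ^ maxLevel c c' n * (2 * A + 1)) := by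
  have h1 := tsum_weight_mul_measure_le hB.phi_bump hB.psi_bump hB.A_pos.le μ
    (S := Gam c c' n) (J := Set.Iic (maxLevel c c' n)) (fun p hp ↦ hp.2)
    fun j ↦ ENNReal.ofReal (2 ^ j)
  rw [tsum_indicator_Iic_two_zpow, ← ENNReal.ofReal_mul (by positivity)] at h1
  calc _ ≤ ∑' p : Gam c c' n, ENNReal.ofReal 2 * (ENNReal.ofReal (2 ^ p.1.1) *
        μ {x | wavelet phi psi p x ≠ 0}) := by
        refine ENNReal.tsum_le_tsum fun p ↦ ?_
        rw [ENNReal.ofReal_mul (dilation_pos _).le, ofReal_measureReal, ← mul_assoc,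
          ← ENNReal.ofReal_mul (by norm_num)]
        gcongr
        exact dilation_le _ p.2.1
    _ ≤ ENNReal.ofReal 2 * ENNReal.ofReal (2 * 2 ^ maxLevel c c' n * (2 * A + 1)) := by
        rw [ENNReal.tsum_mul_left]
        gcongr
    _ = _ := by
        rw [← ENNReal.ofReal_mul (by norm_num)]
        ring_nf

/-- Only finitely many empirical coefficients at the levels in use are nonzero. -/
lemma HasBounds.finite_betaTilde_ne_zero (γ c c' : ℝ) {n : ℕ} (x : Fin n → ℝ) :
    {p : ℤ × ℤ | p ∈ Gam c c' n ∧ betaTilde γ psi x p ≠ 0}.Finite := by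
  have hfin : (⋃ i : Fin n, ⋃ j ∈ Set.Icc (-1) (maxLevel c c' n),
      (fun k : ℤ ↦ (j, k)) '' Set.Icc ⌈dilation j * x i - A⌉ ⌊dilation j * x i + A⌋).Finite :=
    Set.finite_iUnion fun i ↦ (Set.finite_Icc _ _).biUnion fun j _ ↦
      (Set.finite_Icc _ _).image _
  refine hfin.subset fun p ⟨hp, hne⟩ ↦ ?_
  have h1 : betaHat psi x p ≠ 0 := fun h0 ↦ hne (by simp [betaTilde, h0])
  obtain ⟨i, -, hi⟩ := Finset.exists_ne_zero_of_sum_ne_zero (right_ne_zero_of_mul h1)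
  have h2 := abs_le.1 (abs_le_of_wavelet_ne_zero hB.phi_bump hB.psi_bump hi)
  simp only [Set.mem_iUnion]
  refine ⟨i, p.1, hp, p.2, ⟨?_, ?_⟩, rfl⟩
  · rw [Int.ceil_le]; linarith [h2.2]
  · rw [Int.le_floor]; linarith [h2.1]

open Classical in
/-- The estimator is a finite wavelet expansion. -/
lemma HasBounds.exists_estimator_eq_sum (γ c c' : ℝ) {n : ℕ} (x : Fin n → ℝ) :
    ∃ s : Finset Lam,
      (∀ p : Lam, p ∉ s → (if p.1 ∈ Gam c c' n then betaTilde γ psi x p else 0) = 0) ∧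
      ∀ y, estimator γ c c' psi phit psit x y =
        ∑ p ∈ s, (if p.1 ∈ Gam c c' n then betaTilde γ psi x p else 0) *
          wavelet phit psit p y := by
  have hfin : {p : Lam | (if p.1 ∈ Gam c c' n then betaTilde γ psi x p else 0) ≠ 0}.Finite := by
    refine ((hB.finite_betaTilde_ne_zero γ c c' x).preimage
      Subtype.val_injective.injOn).subset fun p hp ↦ ?_
    simpa using hp
  refine ⟨hfin.toFinset, fun p hp ↦ by simpa using hp, fun y ↦ ?_⟩
  have h1 : ∑' p : Lam, (if p.1 ∈ Gam c c' n then betaTilde γ psi x p else 0) *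
      wavelet phit psit p y = ∑ p ∈ hfin.toFinset,
        (if p.1 ∈ Gam c c' n then betaTilde γ psi x p else 0) * wavelet phit psit p y :=
    tsum_eq_sum fun p hp ↦ by
      have : (if p.1 ∈ Gam c c' n then betaTilde γ psi x p else 0) = 0 := by
        simpa using hp
      rw [this, zero_mul]
  rw [estimator, ← h1,
    tsum_subtype (Gam c c' n) fun p ↦ betaTilde γ psi x p * wavelet phit psit p y,
    tsum_subtype Lam fun p ↦
      (if p ∈ Gam c c' n then betaTilde γ psi x p else 0) * wavelet phit psit p y]
  refine tsum_congr fun p ↦ ?_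
  by_cases hp : p ∈ Gam c c' n
  · simp [hp, Gam_subset_Lam c c' n hp]
  · by_cases hp' : p ∈ Lam <;> simp [hp, hp']

end Sums

open Classical in
lemma tsum_ite_Gam_eq (b β : ℤ × ℤ → ℝ) (c c' : ℝ) (n : ℕ) :
    ∑' p : Lam, ENNReal.ofReal (((if p.1 ∈ Gam c c' n then b p else 0) - β p) ^ 2)
      = ∑' p : Gam c c' n, ENNReal.ofReal ((b p - β p) ^ 2)
        + ∑' p : (Lam \ Gam c c' n : Set (ℤ × ℤ)), ENNReal.ofReal (β p ^ 2) := by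
  rw [tsum_subtype Lam fun p ↦
      ENNReal.ofReal (((if p ∈ Gam c c' n then b p else 0) - β p) ^ 2),
    tsum_subtype (Gam c c' n) fun p ↦ ENNReal.ofReal ((b p - β p) ^ 2),
    tsum_subtype (Lam \ Gam c c' n) fun p ↦ ENNReal.ofReal (β p ^ 2), ← ENNReal.tsum_add]
  refine tsum_congr fun p ↦ ?_
  by_cases hp : p ∈ Gam c c' n
  · simp [hp, Gam_subset_Lam c c' n hp]
  · by_cases hp' : p ∈ Lam <;> simp [hp, hp']

/-- The number of wavelets per unit length at the finest level is `o(n ^ a)` for every `a > c`. -/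
lemma eventually_two_zpow_maxLevel_mul_exp_le {c a : ℝ} (hc : 0 < c) (hca : c < a) (c' : ℝ) :
    ∀ᶠ n : ℕ in atTop, (2 : ℝ) ^ maxLevel c c' n * Real.exp (-(a * Real.log n)) ≤ 1 := by
  have h1 := ((isLittleO_log_rpow_rpow_atTop c' (sub_pos.2 hca)).bound one_pos).and
    ((isLittleO_log_rpow_rpow_atTop (-c') hc).bound one_pos)
  have h2 := (tendsto_natCast_atTop_atTop (R := ℝ)).eventually h1
  filter_upwards [h2, eventually_ge_atTop 3] with n hn hn3
  obtain ⟨h3, h4⟩ := hn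
  have hn' : (0 : ℝ) < n := by exact_mod_cast (by lia : 0 < n)
  have hlog : 0 < Real.log n := Real.log_pos (by exact_mod_cast (by lia : 1 < n))
  have p1 : 0 < Real.log n ^ c' := Real.rpow_pos_of_pos hlog _
  have p2 : 0 < (n : ℝ) ^ c := Real.rpow_pos_of_pos hn' _
  rw [one_mul, Real.norm_of_nonneg (by positivity), Real.norm_of_nonneg (by positivity)] at h3 h4
  set x := (n : ℝ) ^ c * Real.log n ^ c' with hx
  have hx1 : 1 ≤ x := by
    rw [Real.rpow_neg hlog.le, inv_le_iff_one_le_mul₀ p1] at h4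
    exact h4
  have hfl : (1 : ℤ) ≤ ⌊x⌋ := Int.le_floor.2 (by exact_mod_cast hx1)
  have hfl' : (0 : ℝ) < ⌊x⌋ := by exact_mod_cast (by lia : (0 : ℤ) < ⌊x⌋)
  have h5 : (2 : ℝ) ^ maxLevel c c' n ≤ x := by
    rw [maxLevel, ← Real.rpow_intCast]
    calc (2 : ℝ) ^ ((⌊Real.logb 2 (⌊x⌋ : ℤ)⌋ : ℤ) : ℝ) ≤ 2 ^ Real.logb 2 (⌊x⌋ : ℤ) :=
          Real.rpow_le_rpow_of_exponent_le (by norm_num) (Int.floor_le _)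
      _ = ⌊x⌋ := Real.rpow_logb (by norm_num) (by norm_num) hfl'
      _ ≤ x := Int.floor_le x
  have h6 : Real.exp (-(a * Real.log n)) = ((n : ℝ) ^ a)⁻¹ := by
    rw [← Real.rpow_neg hn'.le, Real.rpow_def_of_pos hn']
    ring_nf
  rw [h6, ← div_eq_mul_inv, div_le_one (Real.rpow_pos_of_pos hn' _)]
  refine h5.trans ?_
  calc x ≤ (n : ℝ) ^ c * (n : ℝ) ^ (a - c) := by rw [hx]; gcongr
    _ = (n : ℝ) ^ a := by rw [← Real.rpow_add hn']; ring_nf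

/-! ### The oracle inequality -/

/-- The integrated squared error is controlled, for every sample, by the squared errors of the
coefficients. -/
lemma IsBiorthogonalWaveletBasis.exists_eLpNorm_estimator_sub_le {r : ℝ} {psi phit psit : ℝ → ℝ}
    (hb : IsBiorthogonalWaveletBasis r psi phit psit) :
    ∃ K : ℝ, 0 < K ∧ ∀ f : ℝ → ℝ, MemLp f 2 volume →
      (∀ s : Finset Lam, ∑ p ∈ s, coef psi f p ^ 2 ≤ K * (eLpNorm f 2 volume).toReal ^ 2) ∧
      ∀ (γ c c' : ℝ) (n : ℕ) (x : Fin n → ℝ),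
        eLpNorm (fun y ↦ estimator γ c c' psi phit psit x y - f y) 2 volume ^ 2 ≤
          ENNReal.ofReal K *
            (∑' p : Gam c c' n, ENNReal.ofReal ((betaTilde γ psi x p - coef psi f p) ^ 2)
            + ∑' p : (Lam \ Gam c c' n : Set (ℤ × ℤ)), ENNReal.ofReal (coef psi f p ^ 2)) := by
  classical
  obtain ⟨A, M, m, hB⟩ := hb.exists_hasBounds
  obtain ⟨K, K0, hK⟩ := hb.exists_frame_bounds
  refine ⟨K, K0, fun f hf ↦ ⟨(hK f hf).1, fun γ c c' n x ↦ ?_⟩⟩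
  obtain ⟨s, hs0, hs⟩ := hB.exists_estimator_eq_sum γ c c' x
  simp_rw [hs]
  refine ((hK f hf).2 s (fun p ↦ if p.1 ∈ Gam c c' n then betaTilde γ psi x p else 0)
    hs0).trans (le_of_eq ?_)
  rw [← tsum_ite_Gam_eq]

lemma summable_subset {α : Type*} (β : α → ℝ) {S T : Set α} (hST : S ⊆ T)
    (h : Summable fun p : T ↦ β p) : Summable fun p : S ↦ β p :=
  h.comp_injective (i := Set.inclusion hST) (Set.inclusion_injective hST)

/-- Summation of the risk bounds of the single coefficients. The four terms are the oracle risk,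
the contribution of the low levels, a fraction of `‖f‖₂ ^ 2`, and the accumulated cost of the rare
bad events. -/
lemma HasBounds.tsum_risk_bound_le {A M m : ℝ} {psi phit psit : ℝ → ℝ}
    (hB : HasBounds A M m psi phit psit) (μ : Measure ℝ) [IsProbabilityMeasure μ] (c c' : ℝ) (n : ℕ)
    {C T l E V : ℝ} (hC : 0 ≤ C) (hT : 0 ≤ T) (hl : 0 ≤ l) (hE : 0 ≤ E) (hV : 0 ≤ V)
    {τ β : ℤ × ℤ → ℝ} (hτ : ∀ p, 0 ≤ τ p) (hτs : Summable fun p : Gam c c' n ↦ τ p)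
    (hβ : ∑' p : Gam c c' n, ENNReal.ofReal (β p ^ 2) ≤ ENNReal.ofReal V) :
    ∑' p : Gam c c' n, ENNReal.ofReal (C * (τ p
        + T * ((dilation p.1.1)⁻¹ * μ.real {x | wavelet phi psi p x ≠ 0})
        + β p ^ 2 * E + l * E * (dilation p.1.1 * μ.real {x | wavelet phi psi p x ≠ 0}))) ≤
      ENNReal.ofReal (C * (∑' p : Gam c c' n, τ p + T * (4 * (2 * A + 1)) + V * E
        + l * E * (4 * 2 ^ maxLevel c c' n * (2 * A + 1)))) := by
  have hA := hB.A_pos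
  have e1 : ∀ {u v w z : ℝ}, 0 ≤ u → 0 ≤ v → 0 ≤ w → 0 ≤ z →
      ENNReal.ofReal (C * (u + v + w + z)) = ENNReal.ofReal C *
        (ENNReal.ofReal u + ENNReal.ofReal v + ENNReal.ofReal w + ENNReal.ofReal z) := by
    intro u v w z hu hv hw hz
    rw [ENNReal.ofReal_mul hC, ENNReal.ofReal_add (by positivity) hz,
      ENNReal.ofReal_add (by positivity) hw, ENNReal.ofReal_add hu hv]
  have hd : ∀ j, 0 ≤ dilation j := fun j ↦ (dilation_pos j).le
  have hF : ∀ p, 0 ≤ μ.real {x | wavelet phi psi p x ≠ 0} := fun p ↦ measureReal_nonneg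
  have h2 := fun p : Gam c c' n ↦ e1 (hτ p)
    (mul_nonneg hT (mul_nonneg (inv_nonneg.2 (hd p.1.1)) (hF p)))
    (mul_nonneg (sq_nonneg (β p)) hE)
    (mul_nonneg (mul_nonneg hl hE) (mul_nonneg (hd p.1.1) (hF p)))
  rw [tsum_congr h2, e1 (tsum_nonneg fun p : Gam c c' n ↦ hτ p.1) (by positivity) (by positivity)
    (by positivity), ENNReal.tsum_mul_left, ENNReal.tsum_add, ENNReal.tsum_add, ENNReal.tsum_add]
  refine mul_le_mul_right (add_le_add (add_le_add (add_le_add ?_ ?_) ?_) ?_) _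
  · rw [ENNReal.ofReal_tsum_of_nonneg (fun p : Gam c c' n ↦ hτ p.1) hτs]
  · simp_rw [ENNReal.ofReal_mul hT]
    rw [ENNReal.tsum_mul_left]
    exact mul_le_mul_right (hB.tsum_inv_dilation_mul_le μ c c' n) _
  · simp_rw [ENNReal.ofReal_mul' hE]
    rw [ENNReal.tsum_mul_right]
    exact mul_le_mul_left hβ _
  · simp_rw [ENNReal.ofReal_mul (mul_nonneg hl hE)]
    rw [ENNReal.tsum_mul_left]
    exact mul_le_mul_right (hB.tsum_dilation_mul_le μ c c' n) _

end WaveletThresholding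

theorem theorem1 (r : ℝ) (psi phit psit : ℝ → ℝ)
    (hbasis : IsBiorthogonalWaveletBasis r psi phit psit)
    (γ c : ℝ) (hc : 1 ≤ c) (hγ : c < γ) :
    ∃ C₁ : ℝ, 0 < C₁ ∧ ∀ c' : ℝ, ∃ N : ℕ, ∃ C₂ : ℝ → ℝ, (∀ R, 0 < C₂ R) ∧
      ∀ f : ℝ → ℝ, IsL2Density f → ∀ n : ℕ, N ≤ n →
      ∀ (Ω : Type*) [MeasurableSpace Ω] (P : Measure Ω) [IsProbabilityMeasure P]
        (X : Fin n → Ω → ℝ), iIndepFun X P →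
        (∀ i, HasLaw (X i) (volume.withDensity fun x ↦ ENNReal.ofReal (f x)) P) →
        ∫⁻ ω, eLpNorm
            (fun y ↦ estimator γ c c' psi phit psit (fun i ↦ X i ω) y - f y) 2 volume ^ 2 ∂P
          ≤ ENNReal.ofReal
            (C₁ * ((∑' p : Gam c c' n,
                      min (coef psi f p ^ 2) (Real.log n * (sigmaSq psi f p / n)))
                  + ∑' p : (Lam \ Gam c c' n : Set (ℤ × ℤ)), coef psi f p ^ 2)
              + C₂ (eLpNorm f 2 volume).toReal * Real.log n / n) := by
  have c0 : 0 < c := by linarith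
  obtain ⟨A, M, m, hB⟩ := hbasis.exists_hasBounds
  have hA := hB.A_pos
  obtain ⟨K, K0, hK⟩ := hbasis.exists_eLpNorm_estimator_sub_le
  obtain ⟨a, C, hca, C0, N₁, hN₁⟩ := hbasis.exists_integral_betaTilde_sub_sq_le c0 hγ
  refine ⟨K * (C + 1), by positivity, fun c' ↦ ?_⟩
  obtain ⟨N₂, hN₂⟩ := eventually_atTop.1 (eventually_two_zpow_maxLevel_mul_exp_le c0 hca c')
  refine ⟨max N₁ N₂, fun R ↦ K * C * (R ^ 4 * (4 * (2 * A + 1)) + K * R ^ 2 +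
    4 * (2 * A + 1)), fun R ↦ by positivity,
    fun f hf n hn Ω _ P _ X hX hlaw ↦ ?_⟩
  have := hf.isProbabilityMeasure
  obtain ⟨hn3, hcoef⟩ := hN₁ n ((le_max_left _ _).trans hn)
  have hlevel := hN₂ n ((le_max_right _ _).trans hn)
  obtain ⟨hbessel, hnorm⟩ := hK f hf.memLp
  have hn0 : 0 < n := by lia
  have hn' : (0 : ℝ) < n := by exact_mod_cast hn0
  have hlog1 : 1 ≤ Real.log n := by
    have : (3 : ℝ) ≤ n := by exact_mod_cast hn3
    rw [Real.le_log_iff_exp_le hn']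
    linarith [Real.exp_one_lt_d9]
  set R := (eLpNorm f 2 volume).toReal
  set Q := Measure.pi fun _ : Fin n ↦ densityMeasure f
  set l := Real.log n / n with hl
  set E := Real.exp (-(a * Real.log n)) with hE
  have E0 : 0 < E := Real.exp_pos _
  have l0 : 0 < l := by positivity
  have hEl : E ≤ l := by
    have h1 : E ≤ Real.exp (-Real.log n) := by
      rw [hE, Real.exp_le_exp]
      nlinarith
    rw [Real.exp_neg, Real.exp_log hn', ← one_div] at h1
    exact h1.trans (by rw [hl]; gcongr)
  -- summability of the squared coefficients and of the oracle terms
  have hsumL : Summable fun p : Lam ↦ coef psi f p ^ 2 :=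
    summable_of_sum_le (fun p ↦ sq_nonneg _) hbessel
  have hsumG : Summable fun p : Gam c c' n ↦ coef psi f p ^ 2 :=
    summable_subset (fun p ↦ coef psi f p ^ 2) (Gam_subset_Lam c c' n) hsumL
  have hsumT : Summable fun p : (Lam \ Gam c c' n : Set (ℤ × ℤ)) ↦ coef psi f p ^ 2 :=
    summable_subset (fun p ↦ coef psi f p ^ 2) Set.sdiff_subset hsumL
  have hσ : ∀ p : ℤ × ℤ, 0 ≤ sigmaSq psi f p := fun p ↦
    (hB.isBoundedSample hf p n).variance_nonneg hn0
  have hmin0 : ∀ p : ℤ × ℤ,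
      0 ≤ min (coef psi f p ^ 2) (Real.log n * (sigmaSq psi f p / n)) := fun p ↦
    le_min (sq_nonneg _) (mul_nonneg (by linarith) (div_nonneg (hσ p) hn'.le))
  have hsumM : Summable fun p : Gam c c' n ↦
      min (coef psi f p ^ 2) (Real.log n * (sigmaSq psi f p / n)) :=
    hsumG.of_nonneg_of_le (fun p ↦ hmin0 p) fun p ↦ min_le_left _ _
  have hbesselG : ∑' p : Gam c c' n, ENNReal.ofReal (coef psi f p ^ 2)
      ≤ ENNReal.ofReal (K * R ^ 2) := by
    refine (ENNReal.tsum_comp_le_tsum_of_injective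
      (Set.inclusion_injective (Gam_subset_Lam c c' n))
      fun p : Lam ↦ ENNReal.ofReal (coef psi f p ^ 2)).trans ?_
    rw [← ENNReal.ofReal_tsum_of_nonneg (fun p ↦ sq_nonneg _) hsumL]
    exact ENNReal.ofReal_le_ofReal (Real.tsum_le_of_sum_le (fun p ↦ sq_nonneg _) hbessel)
  set S₁ := ∑' p : Gam c c' n, min (coef psi f p ^ 2) (Real.log n * (sigmaSq psi f p / n))
  set S₂ := ∑' p : (Lam \ Gam c c' n : Set (ℤ × ℤ)), coef psi f p ^ 2
  have S₁0 : 0 ≤ S₁ := tsum_nonneg fun p ↦ hmin0 p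
  have S₂0 : 0 ≤ S₂ := tsum_nonneg fun p ↦ sq_nonneg _
  have hmeas : ∀ p : ℤ × ℤ, Measurable fun x : Fin n → ℝ ↦
      ENNReal.ofReal ((betaTilde γ psi x p - coef psi f p) ^ 2) := fun p ↦ by
    have hm : Measurable fun x : Fin n → ℝ ↦ betaTilde γ psi x p :=
      (measurable_thresholdedMean γ (supNorm psi p)).comp
        (hB.isBoundedSample hf p n).measurable_pi
    exact ((hm.sub_const _).pow_const 2).ennreal_ofReal
  have hG : ∑' p : Gam c c' n,
      ∫⁻ x, ENNReal.ofReal ((betaTilde γ psi x p - coef psi f p) ^ 2) ∂Q ≤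
      ENNReal.ofReal (C * (S₁ + R ^ 4 * l * (4 * (2 * A + 1)) + K * R ^ 2 * E
        + l * E * (4 * 2 ^ maxLevel c c' n * (2 * A + 1)))) :=
    (ENNReal.tsum_le_tsum fun p : Gam c c' n ↦
      hcoef f hf p (Gam_subset_Lam c c' n p.2)).trans
      (hB.tsum_risk_bound_le (densityMeasure f) c c' n C0.le (by positivity) l0.le E0.le
        (by positivity) hmin0 hsumM hbesselG)
  -- the sample has the product distribution
  have hpi : HasLaw (fun ω i ↦ X i ω) Q P := iIndepFun.hasLaw_pi hlaw hX
  refine (lintegral_mono fun ω ↦ hnorm γ c c' n fun i ↦ X i ω).trans ?_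
  rw [hpi.lintegral_comp (f := fun x ↦ ENNReal.ofReal K *
      (∑' p : Gam c c' n, ENNReal.ofReal ((betaTilde γ psi x p - coef psi f p) ^ 2)
      + ∑' p : (Lam \ Gam c c' n : Set (ℤ × ℤ)), ENNReal.ofReal (coef psi f p ^ 2)))
    ((Measurable.add_const (Measurable.tsum fun p : Gam c c' n ↦ hmeas p) _).const_mul
      _).aemeasurable,
    lintegral_const_mul _ (Measurable.add_const
      (Measurable.tsum fun p : Gam c c' n ↦ hmeas p) _),
    lintegral_add_right _ measurable_const, lintegral_const, measure_univ, mul_one,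
    lintegral_tsum fun p : Gam c c' n ↦ (hmeas p).aemeasurable,
    ← ENNReal.ofReal_tsum_of_nonneg (fun p ↦ sq_nonneg _) hsumT]
  refine (mul_le_mul_right (add_le_add_left hG _) _).trans ?_
  rw [← ENNReal.ofReal_add (by positivity) S₂0, ← ENNReal.ofReal_mul K0.le]
  refine ENNReal.ofReal_le_ofReal ?_
  have h1 : K * R ^ 2 * E ≤ K * R ^ 2 * l := by gcongr
  have h2 : l * E * (4 * 2 ^ maxLevel c c' n * (2 * A + 1)) ≤ l * (4 * (2 * A + 1)) := by
    calc l * E * (4 * 2 ^ maxLevel c c' n * (2 * A + 1))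
        = l * (4 * (2 * A + 1)) * (2 ^ maxLevel c c' n * E) := by ring
      _ ≤ l * (4 * (2 * A + 1)) := mul_le_of_le_one_right (by positivity) hlevel
  have h3 : K * (C * (R ^ 4 * l * (4 * (2 * A + 1)) + K * R ^ 2 * E
      + l * E * (4 * 2 ^ maxLevel c c' n * (2 * A + 1)))) ≤
      K * (C * (R ^ 4 * l * (4 * (2 * A + 1)) + K * R ^ 2 * l + l * (4 * (2 * A + 1)))) := by
    gcongr
  have h4 : K * C * (R ^ 4 * (4 * (2 * A + 1)) + K * R ^ 2 + 4 * (2 * A + 1)) * Real.log n / n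
      = K * (C * (R ^ 4 * l * (4 * (2 * A + 1)) + K * R ^ 2 * l + l * (4 * (2 * A + 1)))) := by
    rw [hl]; ring
  have h5 : 0 ≤ K * S₁ := by positivity
  have h6 : 0 ≤ K * C * S₂ := by positivity
  rw [h4]
  linarith
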